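/- Let $\Gamma$ be a subgroup of finite index of $\mathrm{SL}_2(\mathbb{Z})$, let $r\in\mathbb{R}$, and let $f$ be a modular form of weight $r$ for $\Gamma$ with unimodular multipliers $(\mu_\gamma)_{\gamma\in\Gamma}$; that is, $f$ is holomorphic on the upper half-plane $\mathbb{H}$, satisfies $f(\gamma z)=\mu_\gamma (cz+d)^r f(z)$ for all $\gamma=\left(\begin{smallmatrix}a&b\\c&d\end{smallmatrix}\right)\in\Gamma$ and $z\in\mathbb{H}$ (powers taken with $-\pi<\arg\le\pi$), and grows at most polynomially as $\operatorname{Im} z\to0^+$: $|f(z)|\le C(\operatorname{Im} z)^{-N}$ for some $N\ge 0$, $C$, and all $z$ with $\operatorname{Im} z$ small enough. For a cusp $\mathfrak a\in\mathbb{Q}\cup\{\infty\}$ let $m_{\mathfrak a}$ be its width (the order of the stabilizer of $\mathfrak a$ in $\mathrm{SL}_2(\mathbb{Z})$ modulo $\Gamma$), and let $\sigma_{\mathfrak a}=\gamma\left(\begin{smallmatrix}\sqrt{m_{\mathfrak a}}&0\\0&1/\sqrt{m_{\mathfrak a}}\end{smallmatrix}\right)$, where $\gamma\in\mathrm{SL}_2(\mathbb{Z})$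 satisfies $\gamma(\infty)=\mathfrak a$ and has bottom row $(c,d)$ with $c<0$, or $c=0$ and $d=1$. Writing $(c',d')$ for the bottom row of $\sigma_{\mathfrak a}$, one has a Fourier expansion $$\frac{f(\sigma_{\mathfrak a}z)}{(c'z+d')^{r}}=\sum_{n\ge0}a_n^{\mathfrak a}e^{2\pi i(n+\kappa_{\mathfrak a})z}\qquad(z\in\mathbb{H}),\qquad 0\le\kappa_{\mathfrak a}<1.$$ The form $f$ is called cuspidal at $\mathfrak a$ if $\kappa_{\mathfrak a}>0$ or $a_0^{\mathfrak a}=0$, and $\mathfrak a$ is called non-cuspidal otherwise (this does not depend on the choice of $\gamma$). Assume that $f$ is not a cusp form, i.e. that at least one cusp is non-cuspidal. For $x\in\mathbb{R}$ let $\tau_x\in[-\infty,+\infty]$ be the supremum of all $\tau\in\mathbb{R}$ for which there is a constant $C$ such that $$\left|x-\frac pq\right|\le\frac{C}{q^{\tau}}$$ holds for infinitely many non-cuspidal rationals $p/q$ (written in lowest terms with $q\geq 1$). Then, for every $2\le\tau\le+\infty$, the Hausdorff dimension of the set $\{x\in\mathbb{R}:\tau_x=\tau\}$ is $2/\tau$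 (where $2/\infty=0$). -/

import Mathlib

open scoped MatrixGroups ENNReal Manifold

noncomputable section

/-- `f` is a modular form of real weight `r` for the subgroup `Γ` of `SL(2, ℤ)` with unimodular
multipliers `μ`: it is holomorphic on the upper half-plane, it satisfies
`f (γ z) = μ_γ (c z + d) ^ r f z` for every `γ ∈ Γ` with bottom row `(c, d)` (complex powers are
taken with the branch `-π < arg ≤ π`), and it grows at most polynomially as `Im z → 0⁺`. -/
structure IsModularFormOfWeight (Γ : Subgroup SL(2, ℤ)) (r : ℝ) (μ : Γ → Circle)
    (f : UpperHalfPlane → ℂ) : Prop where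
  holomorphic : MDifferentiable 𝓘(ℂ) 𝓘(ℂ) f
  map_smul : ∀ (γ : Γ) (z : UpperHalfPlane),
    f ((γ : SL(2, ℤ)) • z) =
      (μ γ : ℂ) * (((γ : SL(2, ℤ)) 1 0 : ℂ) * (z : ℂ) + ((γ : SL(2, ℤ)) 1 1 : ℂ)) ^ (r : ℂ) * f z
  polynomial_growth : ∃ (N : ℕ) (C δ : ℝ), 0 < δ ∧
    ∀ z : UpperHalfPlane, z.im < δ → ‖f z‖ ≤ C / z.im ^ N

/-- The stabilizer in `SL(2, ℤ)` of a cusp; the cusps are the points of `ℚ ∪ {∞}`. -/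
def cuspStabilizer (𝔞 : OnePoint ℚ) : Subgroup SL(2, ℤ) :=
  (MulAction.stabilizer (GL (Fin 2) ℚ) 𝔞).comap (Matrix.SpecialLinearGroup.mapGL ℚ)

/-- The width of the cusp `𝔞`: the order of the stabilizer of `𝔞` in `SL(2, ℤ)` modulo `Γ`. -/
def cuspWidth (Γ : Subgroup SL(2, ℤ)) (𝔞 : OnePoint ℚ) : ℕ :=
  Γ.relIndex (cuspStabilizer 𝔞)

theorem cuspWidth_pos (Γ : Subgroup SL(2, ℤ)) [Γ.FiniteIndex] (𝔞 : OnePoint ℚ) :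
    0 < cuspWidth Γ 𝔞 :=
  Nat.pos_of_ne_zero (Subgroup.FiniteIndex.index_ne_zero (H := Γ.subgroupOf (cuspStabilizer 𝔞)))

/-- The diagonal matrix with entries `√m` and `1 / √m`. -/
def sqrtDiag (m : ℕ) (hm : 0 < m) : SL(2, ℝ) :=
  ⟨!![√(m : ℝ), 0; 0, 1 / √(m : ℝ)], by
    have : √(m : ℝ) ≠ 0 := (Real.sqrt_pos.2 (Nat.cast_pos.2 hm)).ne'
    simp [Matrix.det_fin_two, this]⟩

/-- `γ ∈ SL(2, ℤ)` maps `∞` to the cusp `𝔞` and is normalized in sign: its bottom row `(c, d)`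
satisfies either `c < 0`, or `c = 0` and `d = 1`. -/
def IsCuspMatrix (γ : SL(2, ℤ)) (𝔞 : OnePoint ℚ) : Prop :=
  Matrix.SpecialLinearGroup.mapGL ℚ γ • (OnePoint.infty : OnePoint ℚ) = 𝔞 ∧
    (γ 1 0 < 0 ∨ (γ 1 0 = 0 ∧ γ 1 1 = 1))

/-- The scaling matrix `γ η` of the cusp `𝔞`, where `γ ∞ = 𝔞` and `η` is the diagonal matrix with
entries `√m` and `1 / √m`, `m` being the width of `𝔞`. -/
def scalingMatrix (Γ : Subgroup SL(2, ℤ)) [Γ.FiniteIndex] (𝔞 : OnePoint ℚ) (γ : SL(2, ℤ)) :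
    SL(2, ℝ) :=
  Matrix.SpecialLinearGroup.map (Int.castRingHom ℝ) γ * sqrtDiag (cuspWidth Γ 𝔞) (cuspWidth_pos Γ 𝔞)

/-- The slash operator of weight `r` for a matrix `σ` of determinant `1`, with bottom row `(c, d)`:
`z ↦ f (σ z) / (c z + d) ^ r`. -/
def slashWeight (r : ℝ) (f : UpperHalfPlane → ℂ) (σ : SL(2, ℝ)) (z : UpperHalfPlane) : ℂ :=
  f (σ • z) / ((σ 1 0 : ℂ) * (z : ℂ) + (σ 1 1 : ℂ)) ^ (r : ℂ)

/-- `∑ n ≥ 0, a n * exp (2 π i (n + κ) z)`, with `0 ≤ κ < 1`, is the Fourier expansion of `f` at the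
cusp `𝔞`, relative to the scaling matrix built from `γ`. -/
def IsCuspExpansion (Γ : Subgroup SL(2, ℤ)) [Γ.FiniteIndex] (r : ℝ) (f : UpperHalfPlane → ℂ)
    (𝔞 : OnePoint ℚ) (γ : SL(2, ℤ)) (κ : ℝ) (a : ℕ → ℂ) : Prop :=
  IsCuspMatrix γ 𝔞 ∧ 0 ≤ κ ∧ κ < 1 ∧ ∀ z : UpperHalfPlane,
    HasSum (fun n : ℕ ↦ a n * Complex.exp (2 * Real.pi * Complex.I * ((n : ℂ) + (κ : ℂ)) * (z : ℂ)))
      (slashWeight r f (scalingMatrix Γ 𝔞 γ) z)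

/-- `f` is cuspidal at the cusp `𝔞`: in its Fourier expansion at `𝔞`, either the cusp parameter `κ`
is positive or the coefficient `a 0` vanishes. (A modular form has an expansion at every cusp,
and whether this condition holds does not depend on the choice of the scaling matrix.) -/
def IsCuspidalAt (Γ : Subgroup SL(2, ℤ)) [Γ.FiniteIndex] (r : ℝ) (f : UpperHalfPlane → ℂ)
    (𝔞 : OnePoint ℚ) : Prop :=
  ∀ (γ : SL(2, ℤ)) (κ : ℝ) (a : ℕ → ℂ), IsCuspExpansion Γ r f 𝔞 γ κ a → 0 < κ ∨ a 0 = 0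

/-- `τ` is an admissible exponent for `x`: for some constant `C`, the inequality
`|x - p/q| ≤ C / q ^ τ` holds for infinitely many rationals `p/q` at which `f` is not cuspidal. -/
def IsNonCuspidalExponent (Γ : Subgroup SL(2, ℤ)) [Γ.FiniteIndex] (r : ℝ) (f : UpperHalfPlane → ℂ)
    (x τ : ℝ) : Prop :=
  ∃ C : ℝ, {y : ℚ | ¬ IsCuspidalAt Γ r f (y : OnePoint ℚ) ∧
    |x - (y : ℝ)| ≤ C / (y.den : ℝ) ^ τ}.Infinite

/-- The exponent of approximation `τ_x` of `x` by non-cuspidal rationals: the supremum, possibly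
infinite, of the admissible exponents. -/
def nonCuspidalExponent (Γ : Subgroup SL(2, ℤ)) [Γ.FiniteIndex] (r : ℝ) (f : UpperHalfPlane → ℂ)
    (x : ℝ) : EReal :=
  sSup {t : EReal | ∃ τ : ℝ, t = (τ : EReal) ∧ IsNonCuspidalExponent Γ r f x τ}

end

/-!
The slash operators of `f` at a cusp and at its translate by an element of `Γ` are proportional,
because two continuous logarithms of the same automorphy factor differ by a constant. So the
non-cuspidal rationals contain a full `Γ`-orbit. As `Γ` has finite index, every `p / q` has a point
of this orbit of denominator `O(q)` within `O(1 / q ^ 2)`; combined with Dirichlet's theorem and a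
comparison of volumes, this puts at least `c ρ Q ^ 2` orbit points of denominator at most `Q` in
every interval of length `2 ρ`, for arbitrarily large `Q`.

For any set `O` of rationals, the points approximable by `O` to an exponent `t > 2 / s` are null for
the `s`-dimensional Hausdorff measure, which bounds the dimension from above. If `O` is plentiful in
the above sense, one builds a tree of points of `O` whose branches converge to points approximable
to the exponent `τ`. The natural measure on the branches has an image that is absolutely continuous
with respect to the `s`-dimensional Hausdorff measure for all `s < 2 / τ`; hence it gives no mass to
the points of exponent larger than `τ`, nor to any set of dimension less than `2 / τ`.
-/

open UpperHalfPlane Filter MeasureTheory Topology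
open Matrix.SpecialLinearGroup (mapGL)

/-! ### Cuspidality along orbits -/

/-- `f` transforms with weight `r` under `Γ`, up to nonzero multipliers `μ`. This is the part of the
definition of a modular form that makes the non-cuspidal cusps a union of `Γ`-orbits. -/
def IsAutomorphic (Γ : Subgroup SL(2, ℤ)) (r : ℝ) (μ : Γ → ℂˣ) (f : ℍ → ℂ) : Prop :=
  ∀ (γ : Γ) (z : ℍ), f ((γ : SL(2, ℤ)) • z) = μ γ * denom (γ : SL(2, ℤ)) z ^ (r : ℂ) * f z

theorem IsModularFormOfWeight.isAutomorphic {Γ : Subgroup SL(2, ℤ)} {r : ℝ} {μ : Γ → Circle}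
    {f : ℍ → ℂ} (hf : IsModularFormOfWeight Γ r μ f) :
    IsAutomorphic Γ r (fun γ ↦ Circle.toUnits (μ γ)) f := fun γ z ↦ by
  rw [ModularGroup.denom_apply]
  exact hf.map_smul γ z

theorem exists_exp_mul_eq_mul_exp_mul {X : Type*} [TopologicalSpace X] [PreconnectedSpace X]
    {L M : X → ℂ} (hL : Continuous L) (hM : Continuous M) {e : ℂ}
    (h : ∀ x, Complex.exp (L x) = e * Complex.exp (M x)) (r : ℂ) :
    ∃ K ≠ 0, ∀ x, Complex.exp (L x * r) = K * Complex.exp (M x * r) := by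
  rcases isEmpty_or_nonempty X with _ | ⟨⟨x₀⟩⟩
  · exact ⟨1, one_ne_zero, isEmptyElim⟩
  have hexp (x : X) : Complex.exp (L x - M x) = e := by
    rw [Complex.exp_sub, h, mul_div_cancel_right₀ _ (Complex.exp_ne_zero _)]
  have hconst (x : X) : L x - M x = L x₀ - M x₀ :=
    Complex.isCoveringMap_exp.const_of_comp (hL.sub hM)
      (fun x y ↦ Subtype.ext ((hexp x).trans (hexp y).symm)) x x₀
  refine ⟨Complex.exp ((L x₀ - M x₀) * r), Complex.exp_ne_zero _, fun x ↦ ?_⟩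
  rw [← Complex.exp_add, ← hconst]
  ring_nf

theorem continuous_log_denom (g : GL (Fin 2) ℝ) :
    Continuous fun z : ℍ ↦ Complex.log (denom g z) := by
  by_cases hc : g 1 0 = 0
  · simpa [denom, hc] using! continuous_const
  · refine Continuous.clog (by unfold denom; fun_prop) fun z ↦ Or.inr ?_
    simp [denom, hc, z.im_ne_zero]

theorem denom_specialLinearGroup_mul (g σ : SL(2, ℝ)) (z : ℍ) :
    denom (g * σ : SL(2, ℝ)) z = denom g (σ • z : ℍ) * denom σ z := by
  have hσ : UpperHalfPlane.σ (σ : GL (Fin 2) ℝ) = .refl ℝ ℂ := if_pos (by simp)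
  rw [map_mul, denom_cocycle_σ, hσ]
  rfl

theorem exists_slashWeight_neg (r : ℝ) (f : ℍ → ℂ) (σ : SL(2, ℝ)) :
    ∃ K ≠ 0, ∀ z, slashWeight r f (-σ) z = K * slashWeight r f σ z := by
  have hexp (z : ℍ) :
      Complex.exp (Complex.log (denom σ z)) = -1 * Complex.exp (Complex.log (denom (-σ) z)) := by
    rw [Complex.exp_log (denom_ne_zero _ z), Complex.exp_log (denom_ne_zero _ z), denom_neg]
    ring
  obtain ⟨K, hK, h⟩ := exists_exp_mul_eq_mul_exp_mul (continuous_log_denom σ)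
    (continuous_log_denom (-σ)) hexp r
  refine ⟨K, hK, fun z ↦ ?_⟩
  have hsmul : (-σ) • z = σ • z := by
    ext
    simp [coe_specialLinearGroup_apply, ← neg_add_rev, add_comm]
  have hpow : denom σ z ^ (r : ℂ) = K * denom (-σ) z ^ (r : ℂ) := by
    simpa only [Complex.cpow_def_of_ne_zero (denom_ne_zero _ z)] using h z
  have hcoe : denom (-σ : SL(2, ℝ)) z = denom (-σ) z := rfl
  change f ((-σ) • z) / denom (-σ : SL(2, ℝ)) z ^ (r : ℂ) = K * (f (σ • z) / denom σ z ^ (r : ℂ))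
  rw [hsmul, hcoe, hpow, ← mul_div_assoc, mul_div_mul_left _ _ hK]

theorem IsAutomorphic.exists_slashWeight_mul {Γ : Subgroup SL(2, ℤ)} {r : ℝ} {μ : Γ → ℂˣ}
    {f : ℍ → ℂ} (hf : IsAutomorphic Γ r μ f) (γ : Γ) (σ : SL(2, ℝ)) :
    ∃ K ≠ 0, ∀ z, slashWeight r f
      (Matrix.SpecialLinearGroup.map (Int.castRingHom ℝ) (γ : SL(2, ℤ)) * σ) z =
        K * slashWeight r f σ z := by
  set g := Matrix.SpecialLinearGroup.map (Int.castRingHom ℝ) (γ : SL(2, ℤ))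
  have hexp (z : ℍ) :
      Complex.exp (Complex.log (denom g (σ • z : ℍ)) + Complex.log (denom σ z)) =
        1 * Complex.exp (Complex.log (denom (g * σ : SL(2, ℝ)) z)) := by
    rw [Complex.exp_add, Complex.exp_log (denom_ne_zero _ _), Complex.exp_log (denom_ne_zero _ z),
      Complex.exp_log (denom_ne_zero _ z), denom_specialLinearGroup_mul, one_mul]
  have hcont : Continuous fun z : ℍ ↦
      Complex.log (denom g (σ • z : ℍ)) + Complex.log (denom σ z) :=
    ((continuous_log_denom g).comp (continuous_const_smul σ)).add (continuous_log_denom σ)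
  obtain ⟨K, hK, h⟩ := exists_exp_mul_eq_mul_exp_mul hcont
    (continuous_log_denom (g * σ : SL(2, ℝ))) hexp r
  refine ⟨μ γ * K, mul_ne_zero (μ γ).ne_zero hK, fun z ↦ ?_⟩
  have hpow : denom g (σ • z : ℍ) ^ (r : ℂ) * denom σ z ^ (r : ℂ) =
      K * denom (g * σ : SL(2, ℝ)) z ^ (r : ℂ) := by
    simpa only [Complex.cpow_def_of_ne_zero (denom_ne_zero _ _), ← Complex.exp_add, ← add_mul]
      using h z
  have hf' : f ((g * σ) • z) = μ γ * denom g (σ • z : ℍ) ^ (r : ℂ) * f (σ • z) := by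
    rw [mul_smul]
    exact hf γ (σ • z)
  change f ((g * σ) • z) / denom (g * σ : SL(2, ℝ)) z ^ (r : ℂ) =
    μ γ * K * (f (σ • z) / denom σ z ^ (r : ℂ))
  have hne (τ : SL(2, ℝ)) : denom τ z ^ (r : ℂ) ≠ 0 :=
    Complex.cpow_ne_zero_iff.2 (.inl (denom_ne_zero _ z))
  rw [hf', div_eq_iff (hne _)]
  field_simp [hne σ]
  linear_combination f (σ • z) * hpow

open scoped Pointwise in
theorem smul_cuspStabilizer (g : SL(2, ℤ)) (𝔞 : OnePoint ℚ) :
    MulAut.conj g • cuspStabilizer 𝔞 =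
      cuspStabilizer (mapGL ℚ g • 𝔞) := by
  ext x
  simp only [Subgroup.mem_pointwise_smul_iff_inv_smul_mem, ← map_inv, MulAut.smul_def,
    MulAut.conj_apply, inv_inv, cuspStabilizer, Subgroup.mem_comap, MulAction.mem_stabilizer_iff,
    map_mul, mul_smul]
  rw [map_inv, inv_smul_eq_iff]

open scoped Pointwise in
theorem cuspWidth_smul {Γ : Subgroup SL(2, ℤ)} {γ : SL(2, ℤ)} (hγ : γ ∈ Γ) (𝔞 : OnePoint ℚ) :
    cuspWidth Γ (mapGL ℚ γ • 𝔞) = cuspWidth Γ 𝔞 := by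
  have hΓ : MulAut.conj γ • Γ = Γ := Subgroup.conj_smul_eq_self_of_mem hγ
  rw [cuspWidth, ← smul_cuspStabilizer]
  conv_lhs => rw [← hΓ]
  exact Subgroup.relIndex_pointwise_smul _ _ _

theorem scalingMatrix_smul_mul {Γ : Subgroup SL(2, ℤ)} [Γ.FiniteIndex] {γ : SL(2, ℤ)} (hγ : γ ∈ Γ)
    (𝔞 : OnePoint ℚ) (δ : SL(2, ℤ)) :
    scalingMatrix Γ (mapGL ℚ γ • 𝔞) (γ * δ) =
      Matrix.SpecialLinearGroup.map (Int.castRingHom ℝ) γ * scalingMatrix Γ 𝔞 δ := by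
  simp only [scalingMatrix, cuspWidth_smul hγ, map_mul, mul_assoc]

theorem scalingMatrix_neg (Γ : Subgroup SL(2, ℤ)) [Γ.FiniteIndex] (𝔞 : OnePoint ℚ)
    (δ : SL(2, ℤ)) : scalingMatrix Γ 𝔞 (-δ) = -scalingMatrix Γ 𝔞 δ := by
  ext i j
  simp [scalingMatrix]

theorem isCuspMatrix_or_isCuspMatrix_neg (g : SL(2, ℤ)) :
    IsCuspMatrix g (mapGL ℚ g • OnePoint.infty) ∨
      IsCuspMatrix (-g) (mapGL ℚ g • OnePoint.infty) := by
  have hneg : mapGL ℚ (-g) • (OnePoint.infty : OnePoint ℚ) =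
      mapGL ℚ g • OnePoint.infty := by
    simp [OnePoint.smul_infty_eq_ite]
  have hunit : g 1 0 = 0 → g 1 1 = 1 ∨ g 1 1 = -1 := fun h ↦ by
    have hdet := g.det_coe
    rw [Matrix.det_fin_two, h, mul_zero, sub_zero] at hdet
    exact Int.isUnit_iff.1 (.of_mul_eq_one_right _ hdet)
  simp only [IsCuspMatrix, hneg, Matrix.SpecialLinearGroup.coe_neg, Matrix.neg_apply]
  grind

theorem IsAutomorphic.not_isCuspidalAt_smul {Γ : Subgroup SL(2, ℤ)} [Γ.FiniteIndex] {r : ℝ}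
    {μ : Γ → ℂˣ} {f : ℍ → ℂ} (hf : IsAutomorphic Γ r μ f) {𝔞 : OnePoint ℚ}
    (h𝔞 : ¬ IsCuspidalAt Γ r f 𝔞) {γ : SL(2, ℤ)} (hγ : γ ∈ Γ) :
    ¬ IsCuspidalAt Γ r f (mapGL ℚ γ • 𝔞) := by
  simp only [IsCuspidalAt, not_forall] at h𝔞 ⊢
  obtain ⟨δ, κ, a, ⟨⟨hδ, -⟩, hκ₀, hκ₁, hsum⟩, ha⟩ := h𝔞
  suffices ∃ δ', IsCuspMatrix δ' (mapGL ℚ γ • 𝔞) ∧ ∃ K ≠ 0, ∀ z,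
      slashWeight r f (scalingMatrix Γ (mapGL ℚ γ • 𝔞) δ') z =
        K * slashWeight r f (scalingMatrix Γ 𝔞 δ) z by
    obtain ⟨δ', hδ', K, hK, hslash⟩ := this
    refine ⟨δ', κ, fun n ↦ K * a n, ⟨hδ', hκ₀, hκ₁, fun z ↦ ?_⟩, by simpa [hK] using ha⟩
    simpa only [hslash, mul_assoc] using (hsum z).mul_left K
  obtain ⟨K, hK, hmul⟩ := hf.exists_slashWeight_mul ⟨γ, hγ⟩ (scalingMatrix Γ 𝔞 δ)
  rw [← scalingMatrix_smul_mul hγ] at hmul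
  have hcusp := isCuspMatrix_or_isCuspMatrix_neg (γ * δ)
  rw [map_mul, mul_smul, hδ] at hcusp
  rcases hcusp with hpos | hneg
  · exact ⟨γ * δ, hpos, K, hK, hmul⟩
  · obtain ⟨K', hK', hsign⟩ := exists_slashWeight_neg r f
      (scalingMatrix Γ (mapGL ℚ γ • 𝔞) (γ * δ))
    rw [← scalingMatrix_neg] at hsign
    exact ⟨-(γ * δ), hneg, K' * K, mul_ne_zero hK' hK, fun z ↦ by rw [hsign, hmul, mul_assoc]⟩

/-! ### Distribution of the orbit of a cusp -/

/-- Up to the constant `C`, the set `O` approximates every rational `p / q` to within `1 / q ^ 2`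
by points whose denominators are of order at most `q`. -/
def IsWellDistributed (C : ℕ) (O : Set ℚ) : Prop :=
  ∀ y : ℚ, ∃ y' ∈ O, |(y : ℝ) - y'| ≤ C / (y.den : ℝ) ^ 2 ∧ y'.den ≤ C * y.den

theorem IsWellDistributed.mono {C : ℕ} {O O' : Set ℚ} (hO : IsWellDistributed C O)
    (h : O ⊆ O') : IsWellDistributed C O' := fun y ↦ by
  obtain ⟨y', hy', hC⟩ := hO y
  exact ⟨y', h hy', hC⟩

theorem abs_lt_abs_add_mul {a c n : ℤ} (hac : a ≠ 0 ∨ c ≠ 0) (hn : |a| + 2 ≤ n) :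
    |c| < |a + n * c| := by
  rcases eq_or_ne c 0 with rfl | hc
  · simpa using hac
  · have hc₁ : 1 ≤ |c| := Int.one_le_abs hc
    have ha₀ : 0 ≤ |a| := abs_nonneg a
    calc |c| < (|a| + 2) * |c| - |a| := by nlinarith [hc₁, ha₀]
      _ ≤ n * |c| - |a| := by gcongr
      _ = |n * c| - |-a| := by rw [abs_neg, abs_mul, abs_of_nonneg (by linarith : 0 ≤ n)]
      _ ≤ |n * c - -a| := abs_sub_abs_le_abs_sub _ _
      _ = |a + n * c| := by ring_nf

theorem exists_abs_lt_abs_mul_inv_mem (Γ : Subgroup SL(2, ℤ)) [Γ.FiniteIndex] (δ g : SL(2, ℤ)) :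
    ∃ h : SL(2, ℤ), |h 1 0| < |h 0 0| ∧ g * h * δ⁻¹ ∈ Γ := by
  obtain ⟨m, hm, -, hmem⟩ := Subgroup.exists_pow_mem_of_index_ne_zero
    (Subgroup.FiniteIndex.index_ne_zero (H := Γ)) (g * ModularGroup.T * g⁻¹)
  set x := g⁻¹ * δ
  set k : ℕ := (x 0 0).natAbs + 2 with hk
  set h := ModularGroup.T ^ ((m * k : ℕ) : ℤ) * x
  have h00 : h 0 0 = x 0 0 + m * k * x 1 0 := by
    simp [h, ModularGroup.coe_T_zpow, Matrix.mul_apply, Fin.sum_univ_two]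
  have h10 : h 1 0 = x 1 0 := by simp [h]
  refine ⟨h, ?_, ?_⟩
  · have hcol : x 0 0 ≠ 0 ∨ x 1 0 ≠ 0 := by
      by_contra! hzero
      have hdet := x.det_coe
      rw [Matrix.det_fin_two, hzero.1, hzero.2] at hdet
      simp at hdet
    have hmk : k ≤ m * k := Nat.le_mul_of_pos_left k hm
    rw [h00, h10]
    exact abs_lt_abs_add_mul hcol (by zify at hk hmk; exact hk ▸ hmk)
  · have hconj : g * h * δ⁻¹ = ((g * ModularGroup.T * g⁻¹) ^ m) ^ k := by
      rw [← pow_mul, conj_pow, ← zpow_natCast]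
      simp [h, x, mul_assoc]
    exact hconj ▸ Γ.pow_mem hmem k

theorem exists_bound_mul_inv_mem (Γ : Subgroup SL(2, ℤ)) [Γ.FiniteIndex] (δ : SL(2, ℤ)) :
    ∃ C : ℕ, ∀ g : SL(2, ℤ), ∃ h : SL(2, ℤ),
      |h 1 0| < |h 0 0| ∧ |h 0 0| + |h 1 0| ≤ C ∧ g * h * δ⁻¹ ∈ Γ := by
  choose h hlt hmem using exists_abs_lt_abs_mul_inv_mem Γ δ
  have : Finite (SL(2, ℤ) ⧸ Γ) := Subgroup.finite_quotient_of_finiteIndex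
  obtain ⟨C, hC⟩ := Finite.exists_le fun q : SL(2, ℤ) ⧸ Γ ↦
    (|(h q.out⁻¹) 0 0| + |(h q.out⁻¹) 1 0|).toNat
  refine ⟨C, fun g ↦ ?_⟩
  set q : SL(2, ℤ) ⧸ Γ := QuotientGroup.mk g⁻¹ with hq
  have hgq : g * q.out ∈ Γ := by
    simpa using QuotientGroup.eq.1 (hq.symm.trans (QuotientGroup.out_eq' q).symm)
  refine ⟨h q.out⁻¹, hlt _, Int.toNat_le.1 (hC q), ?_⟩
  simpa [mul_assoc] using Γ.mul_mem hgq (hmem q.out⁻¹)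

theorem exists_specialLinearGroup_col_eq_num_den (y : ℚ) : ∃ g : SL(2, ℤ),
    g 0 0 = y.num ∧ g 1 0 = y.den ∧ 0 ≤ g 1 1 ∧ g 1 1 ≤ y.den := by
  obtain ⟨u, v, huv⟩ : IsCoprime y.num (y.den : ℤ) := Rat.isCoprime_num_den y
  have hden : (0 : ℤ) < y.den := by exact_mod_cast y.pos
  refine ⟨⟨!![y.num, -v - y.num * (u / y.den); y.den, u % y.den], ?_⟩, rfl, rfl,
    Int.emod_nonneg _ hden.ne', (Int.emod_lt_of_pos _ hden).le⟩
  rw [Matrix.det_fin_two_of]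
  linear_combination huv + y.num * (Int.emod_add_mul_ediv u y.den)

theorem div_sub_div_mul_apply (g h : SL(2, ℤ)) (hg : g 1 0 ≠ 0) (hgh : (g * h) 1 0 ≠ 0) :
    (g 0 0 / g 1 0 : ℝ) - (g * h) 0 0 / (g * h) 1 0 = h 1 0 / (g 1 0 * (g * h) 1 0) := by
  have hdet : (g 0 0 * g 1 1 - g 0 1 * g 1 0 : ℝ) = 1 := by
    exact_mod_cast (Matrix.det_fin_two _).symm.trans g.det_coe
  have hgR : (g 1 0 : ℝ) ≠ 0 := by exact_mod_cast hg
  have hghR : ((g * h) 1 0 : ℝ) ≠ 0 := by exact_mod_cast hgh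
  rw [div_sub_div _ _ hgR hghR]
  congr 1
  simp only [Matrix.SpecialLinearGroup.coe_mul, Matrix.mul_apply, Fin.sum_univ_two, Int.cast_add,
    Int.cast_mul]
  linear_combination (h 1 0 : ℝ) * hdet

theorem abs_mul_apply_mem_Icc {g h : SL(2, ℤ)} (h₀ : 0 ≤ g 1 1) (h₁ : g 1 1 ≤ g 1 0)
    (hlt : |h 1 0| < |h 0 0|) :
    |(g * h) 1 0| ∈ Set.Icc (g 1 0) ((|h 0 0| + |h 1 0|) * g 1 0) := by
  have hmul : (g * h) 1 0 = g 1 0 * h 0 0 + g 1 1 * h 1 0 := by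
    simp [Matrix.mul_apply, Fin.sum_univ_two]
  have hc : |g 1 1 * h 1 0| ≤ g 1 0 * |h 1 0| := by
    rw [abs_mul, abs_of_nonneg h₀]
    gcongr
  have ha : |g 1 0 * h 0 0| = g 1 0 * |h 0 0| := by
    rw [abs_mul, abs_of_nonneg (h₀.trans h₁)]
  rw [hmul]
  constructor
  · have := abs_sub_abs_le_abs_add (g 1 0 * h 0 0) (g 1 1 * h 1 0)
    nlinarith
  · linarith [abs_add_le (g 1 0 * h 0 0) (g 1 1 * h 1 0)]

theorem exists_isWellDistributed_setOf_smul_eq (Γ : Subgroup SL(2, ℤ)) [Γ.FiniteIndex]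
    (𝔞 : OnePoint ℚ) :
    ∃ C, IsWellDistributed C {y : ℚ | ∃ γ ∈ Γ, mapGL ℚ γ • 𝔞 = (y : OnePoint ℚ)} := by
  obtain ⟨δ, rfl⟩ := OnePoint.exists_mem_SL2 ℤ 𝔞
  obtain ⟨C, hC⟩ := exists_bound_mul_inv_mem Γ δ
  refine ⟨C, fun y ↦ ?_⟩
  obtain ⟨g, hg₀, hg₁, hnonneg, hle⟩ := exists_specialLinearGroup_col_eq_num_den y
  obtain ⟨h, hlt, hhC, hmem⟩ := hC g
  obtain ⟨hQ, hQC⟩ := abs_mul_apply_mem_Icc hnonneg (hg₁ ▸ hle) hlt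
  rw [hg₁] at hQ hQC
  have hden : (0 : ℤ) < y.den := by exact_mod_cast y.pos
  have hgh : (g * h) 1 0 ≠ 0 := abs_pos.1 (hden.trans_le hQ)
  refine ⟨(g * h) 0 0 / (g * h) 1 0, ⟨_, hmem, ?_⟩, ?_, ?_⟩
  · rw [← mul_smul, ← map_mul, inv_mul_cancel_right, OnePoint.smul_infty_eq_ite]
    simp only [Matrix.SpecialLinearGroup.mapGL_coe_matrix, Matrix.SpecialLinearGroup.map_apply_coe,
      RingHom.mapMatrix_apply, Matrix.map_apply, algebraMap_int_eq, eq_intCast]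
    exact if_neg (by exact_mod_cast hgh)
  · have hy : (y : ℝ) = g 0 0 / g 1 0 := by
      rw [hg₀, hg₁, Rat.cast_def, Int.cast_natCast]
    have hgR : (y.den : ℝ) ≤ |((g * h) 1 0 : ℝ)| := by exact_mod_cast hQ
    have hcC : |(h 1 0 : ℝ)| ≤ C := by
      exact_mod_cast (le_add_of_nonneg_left (abs_nonneg _)).trans hhC
    push_cast
    rw [hy, div_sub_div_mul_apply g h (hg₁ ▸ hden.ne') hgh, abs_div, abs_mul, hg₁,
      Int.cast_natCast, Nat.abs_cast, sq]
    gcongr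
  · have hdvd := Rat.den_dvd ((g * h) 0 0) ((g * h) 1 0)
    rw [Rat.divInt_eq_div, ← dvd_abs] at hdvd
    have hle := (Int.le_of_dvd (abs_pos.2 hgh) hdvd).trans hQC
    have hC' : (|h 0 0| + |h 1 0|) * (y.den : ℤ) ≤ C * y.den := by gcongr
    exact_mod_cast hle.trans hC'

theorem IsAutomorphic.exists_isWellDistributed {Γ : Subgroup SL(2, ℤ)} [Γ.FiniteIndex] {r : ℝ}
    {μ : Γ → ℂˣ} {f : UpperHalfPlane → ℂ} (hf : IsAutomorphic Γ r μ f)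
    (hcusp : ¬ ∀ 𝔞 : OnePoint ℚ, IsCuspidalAt Γ r f 𝔞) :
    ∃ C, IsWellDistributed C {y : ℚ | ¬ IsCuspidalAt Γ r f (y : OnePoint ℚ)} := by
  obtain ⟨𝔞, h𝔞⟩ := not_forall.1 hcusp
  obtain ⟨C, hC⟩ := exists_isWellDistributed_setOf_smul_eq Γ 𝔞
  refine ⟨C, hC.mono ?_⟩
  rintro y ⟨γ, hγ, hy⟩
  rw [Set.mem_ofPred_eq, ← hy]
  exact hf.not_isCuspidalAt_smul h𝔞 hγ

/-! ### Regular systems of rationals -/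

/-- The fractions `p / q`, not necessarily in lowest terms, at distance at most `ρ` from `x`. -/
noncomputable def fractionsNear (x ρ : ℝ) (q : ℕ) : Finset ℚ :=
  (Finset.Icc ⌈q * (x - ρ)⌉ ⌊q * (x + ρ)⌋).image fun p : ℤ ↦ (p / q : ℚ)

theorem mem_fractionsNear {x ρ : ℝ} {y : ℚ} (hy : |y - x| ≤ ρ) :
    y ∈ fractionsNear x ρ y.den := by
  have hnum : (y.num : ℝ) = y.den * y := by
    exact_mod_cast (Rat.mul_den_eq_num y).symm.trans (mul_comm _ _)
  obtain ⟨hl, hu⟩ := abs_le.1 hy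
  refine Finset.mem_image.2 ⟨y.num, Finset.mem_Icc.2 ⟨Int.ceil_le.2 ?_, Int.le_floor.2 ?_⟩,
    Rat.num_div_den y⟩ <;>
  · rw [hnum]
    gcongr
    linarith

theorem card_fractionsNear_le (x : ℝ) {ρ : ℝ} (hρ : 0 ≤ ρ) (q : ℕ) :
    ((fractionsNear x ρ q).card : ℝ) ≤ 2 * ρ * q + 1 := by
  have hcard : ((fractionsNear x ρ q).card : ℤ) ≤
      max (⌊q * (x + ρ)⌋ + 1 - ⌈q * (x - ρ)⌉) 0 := by
    rw [← Int.toNat_eq_max, ← Int.card_Icc]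
    exact_mod_cast Finset.card_image_le
  have hlow := Int.le_ceil (q * (x - ρ))
  have hupp := Int.floor_le (q * (x + ρ))
  calc ((fractionsNear x ρ q).card : ℝ)
      ≤ max ((⌊q * (x + ρ)⌋ : ℝ) + 1 - ⌈q * (x - ρ)⌉) 0 := by exact_mod_cast hcard
    _ ≤ 2 * ρ * q + 1 := max_le (by linarith) (by positivity)

theorem finite_setOf_rat_den_le (x ρ : ℝ) (n : ℕ) :
    {y : ℚ | |y - x| ≤ ρ ∧ y.den ≤ n}.Finite :=
  ((Finset.Icc 1 n).biUnion (fractionsNear x ρ)).finite_toSet.subset fun y hy ↦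
    Finset.mem_biUnion.2 ⟨y.den, Finset.mem_Icc.2 ⟨y.pos, hy.2⟩, mem_fractionsNear hy.1⟩

/-- Regular systems in the sense of Baker and Schmidt, with the height `y.den ^ 2` and for
arbitrarily large (rather than all large) values of the bound `Q`: every interval of length
`2 * ρ` contains at least `c * ρ * Q ^ 2` points of `O` of denominator at most `Q`. -/
def IsRegularSystem (O : Set ℚ) : Prop :=
  ∃ c : ℝ, 0 < c ∧ ∀ ρ > 0, ∃ᶠ Q : ℕ in atTop, ∀ x : ℝ, ∃ F : Finset ℚ,
    (∀ y ∈ F, y ∈ O ∧ |y - x| ≤ ρ ∧ y.den ≤ Q) ∧ c * ρ * Q ^ 2 ≤ F.card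

theorem volume_real_biUnion_closedBall_le {ι : Type*} (s : Finset ι) (x : ι → ℝ) {r : ι → ℝ}
    (hr : ∀ i, 0 ≤ r i) :
    volume.real (⋃ i ∈ s, Metric.closedBall (x i) (r i)) ≤ ∑ i ∈ s, 2 * r i := by
  simpa only [Real.volume_real_closedBall (hr _)] using
    measureReal_biUnion_finset_le (μ := volume) s fun i ↦ Metric.closedBall (x i) (r i)

theorem two_mul_sub_volume_real_le_card_mul {ι : Type*} {F : Finset ι} {y : ι → ℝ} {x R δ : ℝ}
    {s : Set ℝ} (hR : 0 ≤ R) (hδ : 0 ≤ δ) (hs : Bornology.IsBounded s)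
    (hcover : Metric.closedBall x δ ⊆ s ∪ ⋃ i ∈ F, Metric.closedBall (y i) R) :
    2 * δ - volume.real s ≤ F.card * (2 * R) := by
  have hF : volume.real (⋃ i ∈ F, Metric.closedBall (y i) R) ≤ F.card * (2 * R) :=
    (volume_real_biUnion_closedBall_le F y fun _ ↦ hR).trans_eq (by simp)
  have hbounded : Bornology.IsBounded (s ∪ ⋃ i ∈ F, Metric.closedBall (y i) R) :=
    hs.union ((Bornology.isBounded_biUnion_finset F).2 fun _ _ ↦ Metric.isBounded_closedBall)
  have hvol := (measureReal_mono hcover hbounded.measure_lt_top.ne).trans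
    (measureReal_union_le (μ := volume) _ _)
  rw [Real.volume_real_closedBall hδ] at hvol
  linarith

/-- The Dirichlet neighbourhoods, of radius `1 / (n * q)`, of the fractions `p / q` with `q ≤ m`
that lie in the interval `[x - ρ, x + ρ]`. -/
noncomputable def smallDenBalls (x ρ : ℝ) (n m : ℕ) : Set ℝ :=
  ⋃ i ∈ (Finset.Icc 1 m).sigma (fractionsNear x ρ),
    Metric.closedBall (i.2 : ℝ) (1 / (n * i.1))

theorem volume_real_smallDenBalls_le (x : ℝ) {ρ : ℝ} (hρ : 0 ≤ ρ) (n m : ℕ) :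
    volume.real (smallDenBalls x ρ n m) ≤
      4 * ρ * (m / n) + 2 * ((n : ℝ)⁻¹ * ∑ i ∈ Finset.range m, 1 / ((i : ℝ) + 1)) := by
  have hshift : ∑ q ∈ Finset.Icc 1 m, 1 / (q : ℝ) = ∑ i ∈ Finset.range m, 1 / ((i : ℝ) + 1) := by
    rw [← Finset.Ico_add_one_right_eq_Icc, Finset.range_eq_Ico]
    simpa using (Finset.sum_Ico_add' (fun q : ℕ ↦ 1 / (q : ℝ)) 0 m 1).symm
  calc volume.real (smallDenBalls x ρ n m)
      ≤ ∑ i ∈ (Finset.Icc 1 m).sigma (fractionsNear x ρ), 2 * (1 / (n * i.1) : ℝ) :=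
        volume_real_biUnion_closedBall_le ((Finset.Icc 1 m).sigma (fractionsNear x ρ))
          (fun i ↦ (i.2 : ℝ)) (r := fun i ↦ 1 / (n * i.1)) fun i ↦ by positivity
    _ = ∑ q ∈ Finset.Icc 1 m, ((fractionsNear x ρ q).card : ℝ) * (2 * (1 / (n * q))) := by
        simp only [Finset.sum_sigma, Finset.sum_const, nsmul_eq_mul]
    _ ≤ ∑ q ∈ Finset.Icc 1 m, (4 * ρ / n + 2 * ((n : ℝ)⁻¹ * (1 / q))) := by
        refine Finset.sum_le_sum fun q hq ↦ ?_
        have hq₀ : (q : ℝ) ≠ 0 := by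
          exact_mod_cast (Nat.one_le_iff_ne_zero.1 (Finset.mem_Icc.1 hq).1)
        calc _ ≤ (2 * ρ * q + 1) * (2 * (1 / (n * q))) := by
              gcongr
              exact card_fractionsNear_le x hρ q
          _ = _ := by
              rw [one_div, mul_inv]
              field_simp
              ring
    _ = 4 * ρ * (m / n) + 2 * ((n : ℝ)⁻¹ * ∑ q ∈ Finset.Icc 1 m, 1 / (q : ℝ)) := by
        simp only [Finset.sum_add_distrib, Finset.mul_sum, Finset.sum_const, Nat.card_Icc,
          add_tsub_cancel_right, nsmul_eq_mul]
        ring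
    _ = _ := by rw [hshift]

theorem closedBall_subset_smallDenBalls_union {O : Set ℚ} {C : ℕ}
    (hO : IsWellDistributed C O) (x : ℝ) {ρ : ℝ} {n : ℕ} (hn : 0 < n) (hnρ : 1 / (n : ℝ) ≤ ρ / 2)
    (hR : (16 + C * 16 ^ 2) / (n : ℝ) ^ 2 ≤ ρ / 2) {F : Finset ℚ}
    (hF : ∀ y ∈ O, |y - x| ≤ ρ → y.den ≤ C * n → y ∈ F) :
    Metric.closedBall x (ρ / 2) ⊆ smallDenBalls x ρ n (n / 16) ∪
      ⋃ y ∈ F, Metric.closedBall (y : ℝ) ((16 + C * 16 ^ 2) / (n : ℝ) ^ 2) := by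
  intro z hz
  rw [Metric.mem_closedBall, Real.dist_eq] at hz
  obtain ⟨y, hzy, hyn⟩ := Real.exists_rat_abs_sub_le_and_den_le z hn
  have hn₀ : (0 : ℝ) < n := by exact_mod_cast hn
  have hden : (1 : ℝ) ≤ y.den := by exact_mod_cast y.pos
  replace hzy : |z - y| ≤ 1 / (n * y.den) := hzy.trans (by gcongr; linarith)
  rcases le_or_gt y.den (n / 16) with hsmall | hlarge
  · have hyx : |y - x| ≤ ρ := by
      have hzy' : 1 / (n * y.den : ℝ) ≤ 1 / n := by
        gcongr
        exact le_mul_of_one_le_right hn₀.le hden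
      linarith [abs_sub_le (y : ℝ) z x, abs_sub_comm (y : ℝ) z]
    have hmem : ⟨y.den, y⟩ ∈ (Finset.Icc 1 (n / 16)).sigma (fractionsNear x ρ) :=
      Finset.mem_sigma.2 ⟨Finset.mem_Icc.2 ⟨y.pos, hsmall⟩, mem_fractionsNear hyx⟩
    exact .inl (Set.mem_biUnion hmem hzy)
  · have hn16 : (n : ℝ) ≤ 16 * y.den := by
      exact_mod_cast (by lia : n ≤ 16 * y.den)
    obtain ⟨y', hy'O, hyy', hden'⟩ := hO y
    have hzy' : |z - y'| ≤ (16 + C * 16 ^ 2) / (n : ℝ) ^ 2 := by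
      calc |z - y'| ≤ |z - y| + |(y : ℝ) - y'| := abs_sub_le _ _ _
        _ ≤ 1 / (n * y.den) + C / (y.den : ℝ) ^ 2 := add_le_add hzy hyy'
        _ ≤ 1 / (n * (n / 16)) + C / (n / 16 : ℝ) ^ 2 := by gcongr <;> linarith
        _ = (16 + C * 16 ^ 2) / (n : ℝ) ^ 2 := by field_simp
    have hy'x : |y' - x| ≤ ρ := by
      linarith [abs_sub_le (y' : ℝ) z x, abs_sub_comm (y' : ℝ) z]
    exact .inr (Set.mem_biUnion (hF y' hy'O hy'x (hden'.trans (by gcongr))) hzy')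

theorem IsWellDistributed.eventually_le_card {O : Set ℚ} {C : ℕ}
    (hO : IsWellDistributed C O) {ρ : ℝ} (hρ : 0 < ρ) :
    ∀ᶠ n : ℕ in atTop, ∀ x : ℝ, ∃ F : Finset ℚ,
      (∀ y ∈ F, y ∈ O ∧ |y - x| ≤ ρ ∧ y.den ≤ C * n) ∧
        ρ / (4 * (16 + C * 16 ^ 2)) * n ^ 2 ≤ F.card := by
  have hharmonic : Tendsto (fun n : ℕ ↦ (n : ℝ)⁻¹ * ∑ i ∈ Finset.range n, 1 / ((i : ℝ) + 1))
      atTop (𝓝 0) := tendsto_one_div_add_atTop_nhds_zero_nat.cesaro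
  have hinv : Tendsto (fun n : ℕ ↦ 1 / (n : ℝ)) atTop (𝓝 0) := tendsto_one_div_atTop_nhds_zero_nat
  have hR : Tendsto (fun n : ℕ ↦ (16 + C * 16 ^ 2) / (n : ℝ) ^ 2) atTop (𝓝 0) :=
    tendsto_const_nhds.div_atTop ((tendsto_pow_atTop two_ne_zero).comp tendsto_natCast_atTop_atTop)
  filter_upwards [eventually_gt_atTop 0, hinv.eventually_le_const (half_pos hρ),
    hR.eventually_le_const (half_pos hρ),
    hharmonic.eventually_le_const (by positivity : 0 < ρ / 8)]
    with n hn hnρ hRρ hsum x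
  have hfin : {y : ℚ | y ∈ O ∧ |y - x| ≤ ρ ∧ y.den ≤ C * n}.Finite :=
    (finite_setOf_rat_den_le x ρ (C * n)).subset fun y hy ↦ hy.2
  refine ⟨hfin.toFinset, fun y ↦ hfin.mem_toFinset.1, ?_⟩
  set F := hfin.toFinset
  set R := (16 + C * 16 ^ 2) / (n : ℝ) ^ 2 with hRdef
  set U := ⋃ y ∈ F, Metric.closedBall (y : ℝ) R
  have hn₀ : (0 : ℝ) < n := by exact_mod_cast hn
  have hcover : Metric.closedBall x (ρ / 2) ⊆ smallDenBalls x ρ n (n / 16) ∪ U :=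
    closedBall_subset_smallDenBalls_union hO x hn hnρ hRρ fun y hyO hyx hyn ↦
      hfin.mem_toFinset.2 ⟨hyO, hyx, hyn⟩
  have hsmall : volume.real (smallDenBalls x ρ n (n / 16)) ≤ ρ / 2 := by
    have hm : ((n / 16 : ℕ) / n : ℝ) ≤ 1 / 16 := by
      rw [div_le_iff₀ hn₀]
      exact Nat.cast_div_le.trans_eq (by push_cast; ring)
    calc _ ≤ _ := volume_real_smallDenBalls_le x hρ.le n (n / 16)
      _ ≤ 4 * ρ * (1 / 16) + 2 * ((n : ℝ)⁻¹ * ∑ i ∈ Finset.range n, 1 / ((i : ℝ) + 1)) := by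
          gcongr
          exact Nat.div_le_self _ _
      _ ≤ ρ / 2 := by linarith
  have hbounded : Bornology.IsBounded (smallDenBalls x ρ n (n / 16)) :=
    (Bornology.isBounded_biUnion_finset _).2 fun _ _ ↦ Metric.isBounded_closedBall
  have hvol := two_mul_sub_volume_real_le_card_mul (by positivity) (half_pos hρ).le hbounded hcover
  calc ρ / (4 * (16 + C * 16 ^ 2)) * n ^ 2 = ρ / 2 / (2 * R) := by
        rw [hRdef]
        field_simp
        ring
    _ ≤ F.card := (div_le_iff₀ (by positivity)).2 (by linarith)

theorem IsWellDistributed.isRegularSystem {C : ℕ} {O : Set ℚ} (hO : IsWellDistributed C O) :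
    IsRegularSystem O := by
  have hC₀ : 0 < C := by
    obtain ⟨y, -, -, hy⟩ := hO 0
    exact Nat.pos_of_mul_pos_right (y.pos.trans_le hy)
  refine ⟨1 / (4 * (16 + C * 16 ^ 2) * C ^ 2), by positivity, fun ρ hρ ↦ ?_⟩
  have hlarge := (hO.eventually_le_card hρ).frequently
  refine (tendsto_id.const_mul_atTop' hC₀).frequently (hlarge.mono fun n hn x ↦ ?_)
  obtain ⟨F, hF, hcard⟩ := hn x
  refine ⟨F, hF, le_of_eq_of_le ?_ hcard⟩
  simp only [id]
  push_cast
  field_simp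

/-! ### Upper bound for the dimension -/

theorem hausdorffMeasure_setOf_infinite_mem_eq_zero {ι X : Type*} [Countable ι] [EMetricSpace X]
    [MeasurableSpace X] [BorelSpace X] {s : ℝ} (hs : 0 < s) {S : ι → Set X}
    (hS : ∑' i, Metric.ediam (S i) ^ s ≠ ∞) : μH[s] {x | {i | x ∈ S i}.Infinite} = 0 := by
  set tail : Finset ι → ℝ≥0∞ := fun F ↦ ∑' i : {i // i ∉ F}, Metric.ediam (S i) ^ s
  have htail : Tendsto tail atTop (𝓝 0) := ENNReal.tendsto_tsum_compl_atTop_zero hS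
  have hroot : Tendsto (fun F ↦ tail F ^ s⁻¹) atTop (𝓝 0) := by
    simpa [hs] using htail.ennrpow_const s⁻¹
  refine nonpos_iff_eq_zero.1 ((Measure.hausdorffMeasure_le_liminf_tsum s _ _ hroot
    (fun F (i : {i // i ∉ F}) ↦ S i) ?_ ?_).trans_eq htail.liminf_eq)
  · exact .of_forall fun F i ↦ (ENNReal.le_rpow_inv_iff hs).2 (ENNReal.le_tsum i)
  · refine .of_forall fun F x hx ↦ ?_
    obtain ⟨i, hi, hiF⟩ := hx.exists_notMem_finset F
    exact Set.mem_iUnion.2 ⟨⟨i, hiF⟩, hi⟩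

/-- `τ` is an exponent to which `x` is approximable by infinitely many elements of `O`. -/
def IsApproxExponent (O : Set ℚ) (x τ : ℝ) : Prop :=
  ∃ C : ℝ, {y : ℚ | y ∈ O ∧ |x - y| ≤ C / (y.den : ℝ) ^ τ}.Infinite

/-- The exponent of approximation of `x` by elements of `O`: the supremum in `[-∞, ∞]` of all
exponents in the sense of `IsApproxExponent`. -/
noncomputable def approxExponent (O : Set ℚ) (x : ℝ) : EReal :=
  sSup {t : EReal | ∃ τ : ℝ, t = τ ∧ IsApproxExponent O x τ}

theorem IsApproxExponent.of_le {O : Set ℚ} {x τ τ' : ℝ} (h : IsApproxExponent O x τ')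
    (hτ : τ ≤ τ') : IsApproxExponent O x τ := by
  obtain ⟨C, hC⟩ := h
  refine ⟨|C|, hC.mono fun y hy ↦ ⟨hy.1, hy.2.trans ?_⟩⟩
  have hden : (1 : ℝ) ≤ y.den := by exact_mod_cast y.pos
  gcongr
  exact le_abs_self C

theorem IsApproxExponent.le_approxExponent {O : Set ℚ} {x τ : ℝ} (h : IsApproxExponent O x τ) :
    τ ≤ approxExponent O x :=
  le_sSup ⟨τ, rfl, h⟩

theorem isApproxExponent_of_lt_approxExponent {O : Set ℚ} {x τ : ℝ}
    (h : τ < approxExponent O x) : IsApproxExponent O x τ := by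
  obtain ⟨_, ⟨τ', rfl, hτ'⟩, hlt⟩ := lt_sSup_iff.1 h
  exact hτ'.of_le (EReal.coe_lt_coe_iff.1 hlt).le

theorem tsum_ediam_closedBall_fractionsNear_ne_top {t s : ℝ} (hs : 0 < s) (hts : 2 < t * s)
    (m : ℕ) :
    ∑' i : Σ q : ℕ, fractionsNear 0 (2 * m) q,
      Metric.ediam (Metric.closedBall (i.2 : ℝ) (m / (i.1 : ℝ) ^ t)) ^ s ≠ ∞ := by
  have hsum : Summable fun q : ℕ ↦ (4 * m + 1) * (2 * m : ℝ) ^ s * (q : ℝ) ^ (1 - t * s) :=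
    (Real.summable_nat_rpow.2 (by linarith)).mul_left _
  refine ne_top_of_le_ne_top hsum.tsum_ofReal_ne_top ?_
  rw [ENNReal.tsum_sigma']
  refine ENNReal.tsum_le_tsum fun q ↦ ?_
  have hdiam (y : ℝ) : Metric.ediam (Metric.closedBall y (m / (q : ℝ) ^ t)) ^ s =
      ENNReal.ofReal ((2 * m / (q : ℝ) ^ t) ^ s) := by
    rw [Real.closedBall_eq_Icc, Real.ediam_Icc, ENNReal.ofReal_rpow_of_nonneg _ hs.le]
    · ring_nf
    · ring_nf
      positivity
  simp only [hdiam, tsum_fintype, Finset.sum_const, Finset.card_univ, Fintype.card_coe]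
  rw [nsmul_eq_mul, ← ENNReal.ofReal_natCast, ← ENNReal.ofReal_mul (by positivity)]
  refine ENNReal.ofReal_le_ofReal ?_
  rcases q.eq_zero_or_pos with rfl | hq
  · have ht : t ≠ 0 := by rintro rfl; linarith
    simpa [Real.zero_rpow ht, Real.zero_rpow hs.ne'] using by positivity
  have hq₁ : (1 : ℝ) ≤ q := by exact_mod_cast hq
  have hq₀ : (0 : ℝ) < q := by linarith
  calc ((fractionsNear 0 (2 * m) q).card : ℝ) * (2 * m / (q : ℝ) ^ t) ^ s
      ≤ (2 * (2 * m) * q + 1) * (2 * m / (q : ℝ) ^ t) ^ s := by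
        gcongr
        exact card_fractionsNear_le 0 (by positivity) q
    _ ≤ ((4 * m + 1) * q) * (2 * m / (q : ℝ) ^ t) ^ s := by
        gcongr
        linarith
    _ = (4 * m + 1) * (2 * m) ^ s * (q : ℝ) ^ (1 - t * s) := by
        rw [Real.div_rpow (by positivity) (by positivity), ← Real.rpow_mul hq₀.le,
          Real.rpow_sub hq₀, Real.rpow_one]
        ring

theorem hausdorffMeasure_setOf_isApproxExponent_eq_zero (O : Set ℚ) {t s : ℝ} (hs : 0 < s)
    (hts : 2 < t * s) : μH[s] {x | IsApproxExponent O x t} = 0 := by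
  have hnull (m : ℕ) := hausdorffMeasure_setOf_infinite_mem_eq_zero hs
    (tsum_ediam_closedBall_fractionsNear_ne_top hs hts m)
  have ht : 0 < t := pos_of_mul_pos_left (two_pos.trans hts) hs.le
  refine measure_mono_null ?_ (measure_iUnion_null hnull)
  rintro x ⟨C, hC⟩
  obtain ⟨m, hm⟩ := exists_nat_ge (max |x| C)
  refine Set.mem_iUnion.2 ⟨m, .of_image (fun i ↦ (i.2 : ℚ)) (hC.mono ?_)⟩
  rintro y ⟨-, hy⟩
  replace hy : |x - y| ≤ m / (y.den : ℝ) ^ t := by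
    refine hy.trans ?_
    gcongr
    exact (le_max_right _ _).trans hm
  have hyx : |x - y| ≤ m :=
    hy.trans (div_le_self m.cast_nonneg (Real.one_le_rpow (by exact_mod_cast y.pos) ht.le))
  have hym : |y - (0 : ℝ)| ≤ 2 * m := by
    rw [sub_zero]
    linarith [abs_sub_abs_le_abs_sub (y : ℝ) x, abs_sub_comm (y : ℝ) x, (le_max_left _ _).trans hm]
  exact ⟨⟨y.den, y, mem_fractionsNear hym⟩, hy, rfl⟩

theorem exists_real_lt_lt_mul_of_div_lt {a s : NNReal} (ha : a ≠ 0) {τ : ℝ≥0∞} (h : a / τ < s) :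
    ∃ t : ℝ, (t : EReal) < τ ∧ a < t * s := by
  have hs : s ≠ 0 := by rintro rfl; simp at h
  have hτ : (a : ℝ≥0∞) / s < τ := by
    rw [ENNReal.div_lt_iff (by simp [ha]) (by simp)] at h ⊢
    rwa [mul_comm]
  obtain ⟨t, hat, htτ⟩ := ENNReal.lt_iff_exists_nnreal_btwn.1 hτ
  rw [ENNReal.div_lt_iff (by simp [hs]) (by simp)] at hat
  refine ⟨t, ?_, by exact_mod_cast hat⟩
  rw [← EReal.coe_nnreal_eq_coe_real]
  exact_mod_cast htτ

theorem dimH_setOf_approxExponent_eq_le (O : Set ℚ) (τ : ℝ≥0∞) :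
    dimH {x | approxExponent O x = τ} ≤ 2 / τ := by
  refine le_of_forall_gt fun b hb ↦ ?_
  obtain ⟨s, hτs, hsb⟩ := ENNReal.lt_iff_exists_nnreal_btwn.1 hb
  have hs : 0 < (s : ℝ) := by exact_mod_cast pos_of_gt hτs
  obtain ⟨t, htτ, hts⟩ := exists_real_lt_lt_mul_of_div_lt two_ne_zero hτs
  refine (dimH_le_of_hausdorffMeasure_ne_top (ne_of_eq_of_ne (measure_mono_null (fun x hx ↦ ?_)
    (hausdorffMeasure_setOf_isApproxExponent_eq_zero O hs hts)) ENNReal.zero_ne_top)).trans_lt hsb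
  exact isApproxExponent_of_lt_approxExponent (htτ.trans_eq hx.symm)

/-! ### Measures on Cantor sets -/

theorem absolutelyContinuous_hausdorffMeasure_of_measure_le {X : Type*} [EMetricSpace X]
    [MeasurableSpace X] [BorelSpace X] {μ : Measure X} {s : ℝ} {C ε : ℝ≥0∞} (hC : C ≠ ∞)
    (hε : 0 < ε) (h : ∀ S, IsClosed S → Metric.ediam S ≤ ε → μ S ≤ C * Metric.ediam S ^ s) :
    μ ≪ μH[s] := by
  have hle : C⁻¹ • μ ≤ μH[s] := by
    refine Measure.le_hausdorffMeasure s _ ε hε fun S hS ↦ ?_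
    rw [← Metric.ediam_closure] at hS ⊢
    rw [Measure.smul_apply, smul_eq_mul, mul_comm, ← div_eq_mul_inv]
    exact ENNReal.div_le_of_le_mul'
      ((measure_mono subset_closure).trans (h _ isClosed_closure hS))
  exact (Measure.absolutelyContinuous_smul (ENNReal.inv_ne_zero.2 hC)).trans
    (Measure.absolutelyContinuous_of_le hle)

theorem card_le_div_add_one_of_le_abs_sub {α : Type*} {A : Finset α} {f : α → ℝ} {g d : ℝ}
    (hg : 0 < g) (hd : 0 ≤ d) (hsep : (A : Set α).Pairwise fun i j ↦ g ≤ |f i - f j|)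
    (hdiam : ∀ i ∈ A, ∀ j ∈ A, |f i - f j| ≤ d) : (A.card : ℝ) ≤ d / g + 1 := by
  rcases A.eq_empty_or_nonempty with rfl | hA
  · simpa using by positivity
  obtain ⟨i₀, hi₀, hmin⟩ := A.exists_min_image f hA
  set φ : α → ℕ := fun i ↦ ⌊(f i - f i₀) / g⌋₊
  have hφ (i) (hi : i ∈ A) : φ i ∈ Finset.range (⌊d / g⌋₊ + 1) := by
    refine Finset.mem_range_succ_iff.2 (Nat.floor_le_floor ?_)
    gcongr
    exact (le_abs_self _).trans (hdiam i hi i₀ hi₀)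
  have hinj : Set.InjOn φ A := by
    intro i hi j hj hij
    by_contra hne
    have hfloor (i) (hi : i ∈ A) : φ i = ⌊(f i - f i₀) / g⌋ :=
      Int.natCast_floor_eq_floor (div_nonneg (sub_nonneg.2 (hmin i hi)) hg.le)
    have hlt := Int.abs_sub_lt_one_of_floor_eq_floor
      ((hfloor i hi).symm.trans ((congrArg _ hij).trans (hfloor j hj)))
    rw [← sub_div, abs_div, abs_of_pos hg, div_lt_one hg, sub_sub_sub_cancel_right] at hlt
    exact (hsep hi hj hne).not_gt hlt
  have hcard := Finset.card_le_card_of_injOn φ hφ hinj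
  rw [Finset.card_range] at hcard
  calc (A.card : ℝ) ≤ ⌊d / g⌋₊ + 1 := by exact_mod_cast hcard
    _ ≤ d / g + 1 := by
      gcongr
      exact Nat.floor_le (by positivity)

section CantorScheme

variable {ι : ℕ → Type*}

/-- Branches of the tree that part at level `k` are mapped by `p` to points at distance at least
`ε k`. -/
structure IsGapSequence (p : (∀ k, ι k) → ℝ) (ε : ℕ → ℝ) : Prop where
  pos (k : ℕ) : 0 < ε k
  antitone : Antitone ε
  tendsto_zero : Tendsto ε atTop (𝓝 0)
  le_abs_sub : ∀ {k : ℕ} {ω ω' : ∀ k, ι k}, (∀ j < k, ω j = ω' j) → ω k ≠ ω' k →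
    ε k ≤ |p ω - p ω'|

namespace IsGapSequence

variable {p : (∀ k, ι k) → ℝ} {ε : ℕ → ℝ}

theorem eq_of_abs_sub_lt (h : IsGapSequence p ε) {k : ℕ} {ω ω' : ∀ k, ι k}
    (hlt : ∀ j < k, |p ω - p ω'| < ε j) : ∀ j < k, ω j = ω' j := by
  intro j hj
  induction j using Nat.strong_induction_on with
  | _ j ih =>
    by_contra hne
    exact (hlt j hj).not_ge (h.le_abs_sub (fun i hi ↦ ih i hi (hi.trans hj)) hne)

theorem ncard_image_le [∀ k, Finite (ι k)] (h : IsGapSequence p ε) {k : ℕ} {B : Set (∀ k, ι k)}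
    (hB : ∀ ω ∈ B, ∀ ω' ∈ B, ∀ j < k, ω j = ω' j) {d : ℝ} (hd : 0 ≤ d)
    (hdiam : ∀ ω ∈ B, ∀ ω' ∈ B, |p ω - p ω'| ≤ d) :
    (((fun ω ↦ ω k) '' B).ncard : ℝ) ≤ d / ε k + 1 := by
  obtain ⟨A, hAB, hA⟩ := Set.SurjOn.exists_bijOn_subset (Set.surjOn_image (fun ω ↦ ω k) B)
  have hfin : A.Finite := hA.finite_iff_finite.2 (Set.toFinite _)
  rw [← hA.image_eq, hA.injOn.ncard_image, Set.ncard_eq_toFinset_card A hfin]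
  refine card_le_div_add_one_of_le_abs_sub (f := p) (h.pos k) hd ?_ ?_
  · intro ω hω ω' hω' hne
    rw [hfin.coe_toFinset] at hω hω'
    exact h.le_abs_sub (hB ω (hAB hω) ω' (hAB hω')) (hA.injOn.ne hω hω' hne)
  · simp only [hfin.mem_toFinset]
    exact fun ω hω ω' hω' ↦ hdiam ω (hAB hω) ω' (hAB hω')

theorem ncard_image_div_card_le [∀ k, Fintype (ι k)] [∀ k, Nonempty (ι k)]
    (h : IsGapSequence p ε) {k : ℕ} {B : Set (∀ k, ι k)}
    (hB : ∀ ω ∈ B, ∀ ω' ∈ B, ∀ j < k, ω j = ω' j) {d : ℝ} (hεd : ε k ≤ d)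
    (hdiam : ∀ ω ∈ B, ∀ ω' ∈ B, |p ω - p ω'| ≤ d) {s : ℝ} (hs₀ : 0 < s) (hs₁ : s ≤ 1) :
    (((fun ω ↦ ω k) '' B).ncard : ℝ) / Fintype.card (ι k) ≤
      (2 * d / (Fintype.card (ι k) * ε k)) ^ s := by
  set N := ((fun ω ↦ ω k) '' B).ncard
  set M := Fintype.card (ι k)
  have hε : 0 < ε k := h.pos k
  have hM : (0 : ℝ) < M := by exact_mod_cast Fintype.card_pos
  have hNM : (N : ℝ) / M ≤ 1 := by
    rw [div_le_one hM]
    exact_mod_cast (Set.ncard_le_card _).trans_eq Nat.card_eq_fintype_card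
  have hNd : (N : ℝ) / M ≤ 2 * d / (M * ε k) := by
    have hone : 1 ≤ d / ε k := (one_le_div hε).2 hεd
    calc (N : ℝ) / M ≤ (d / ε k + 1) / M := by
          gcongr
          exact h.ncard_image_le hB (hε.le.trans hεd) hdiam
      _ ≤ 2 * (d / ε k) / M := by
          gcongr
          linarith
      _ = 2 * d / (M * ε k) := by field_simp
  calc (N : ℝ) / M ≤ (N / M) ^ s := Real.self_le_rpow_of_le_one (by positivity) hNM hs₁
    _ ≤ _ := by gcongr

end IsGapSequence

variable [∀ k, MeasurableSpace (ι k)]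

variable (ι) in
/-- The measure on the branches `∀ k, ι k` of a tree under which the choices made at the
different levels are independent and uniformly distributed. -/
noncomputable def branchMeasure : Measure (∀ k, ι k) :=
  Measure.infinitePi fun _ ↦ ProbabilityTheory.uniformOn Set.univ

instance [∀ k, Finite (ι k)] [∀ k, Nonempty (ι k)] : IsProbabilityMeasure (branchMeasure ι) := by
  unfold branchMeasure
  infer_instance

variable [∀ k, Fintype (ι k)] [∀ k, Nonempty (ι k)] [∀ k, MeasurableSingletonClass (ι k)]

theorem branchMeasure_le {k : ℕ} {B : Set (∀ k, ι k)}
    (hB : ∀ ω ∈ B, ∀ ω' ∈ B, ∀ j < k, ω j = ω' j) :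
    branchMeasure ι B ≤ ENNReal.ofReal ((∏ j ∈ Finset.range k, (Fintype.card (ι j) : ℝ)⁻¹) *
      (((fun ω ↦ ω k) '' B).ncard / Fintype.card (ι k))) := by
  have hsub : B ⊆ (Finset.range (k + 1) : Set ℕ).pi fun j ↦ (fun ω ↦ ω j) '' B :=
    fun ω hω j _ ↦ ⟨ω, hω, rfl⟩
  have hone (j) (hj : j ∈ Finset.range k) : Measure.count ((fun ω : ∀ k, ι k ↦ ω j) '' B) ≤ 1 := by
    have hss : ((fun ω : ∀ k, ι k ↦ ω j) '' B).Subsingleton := by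
      rintro _ ⟨ω, hω, rfl⟩ _ ⟨ω', hω', rfl⟩
      exact hB ω hω ω' hω' j (Finset.mem_range.1 hj)
    rw [Measure.count_apply (Set.toFinite _).measurableSet]
    exact_mod_cast Set.encard_le_one_iff_subsingleton.2 hss
  have hcard (j) : (0 : ℝ) < Fintype.card (ι j) := by exact_mod_cast Fintype.card_pos
  calc branchMeasure ι B ≤ ∏ j ∈ Finset.range (k + 1),
          Measure.count ((fun ω : ∀ k, ι k ↦ ω j) '' B) / Fintype.card (ι j) := by
        refine (measure_mono hsub).trans_eq ?_
        rw [branchMeasure, Measure.infinitePi_pi _ fun _ _ ↦ (Set.toFinite _).measurableSet]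
        simp only [ProbabilityTheory.uniformOn_univ]
    _ ≤ (∏ j ∈ Finset.range k, (Fintype.card (ι j) : ℝ≥0∞)⁻¹) *
          (((fun ω ↦ ω k) '' B).ncard / Fintype.card (ι k)) := by
        rw [Finset.prod_range_succ]
        refine mul_le_mul' (Finset.prod_le_prod' fun j hj ↦ ?_) (le_of_eq ?_)
        · rw [← one_div]
          gcongr
          exact hone j hj
        · rw [Measure.count_apply (Set.toFinite _).measurableSet,
            ← (Set.toFinite ((fun ω : ∀ k, ι k ↦ ω k) '' B)).cast_ncard_eq]
          rfl
    _ = _ := by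
        rw [ENNReal.ofReal_mul (Finset.prod_nonneg fun j _ ↦ (inv_pos.2 (hcard j)).le),
          ENNReal.ofReal_prod_of_nonneg fun j _ ↦ (inv_pos.2 (hcard j)).le,
          ENNReal.ofReal_div_of_pos (hcard k)]
        simp only [ENNReal.ofReal_inv_of_pos (hcard _), ENNReal.ofReal_natCast]

namespace IsGapSequence

variable {p : (∀ k, ι k) → ℝ} {ε : ℕ → ℝ}

theorem branchMeasure_preimage_le (h : IsGapSequence p ε) {s K : ℝ} (hs₀ : 0 < s) (hs₁ : s ≤ 1)
    {k₀ : ℕ} (hK : ∀ k ≥ k₀, ∏ j ∈ Finset.range k, (Fintype.card (ι j) : ℝ)⁻¹ ≤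
      K * (Fintype.card (ι k) * ε k) ^ s) {d : ℝ} (hd : 0 < d) (hdε : d < ε k₀) {S : Set ℝ}
    (hS : ∀ x ∈ S, ∀ y ∈ S, |x - y| ≤ d) :
    branchMeasure ι (p ⁻¹' S) ≤ ENNReal.ofReal (K * (2 * d) ^ s) := by
  classical
  have hsmall : ∃ k, ε k ≤ d := (h.tendsto_zero.eventually_le_const hd).exists
  set k := Nat.find hsmall
  have hεd : ε k ≤ d := Nat.find_spec hsmall
  have hk : k₀ ≤ k := by
    by_contra! hlt
    exact (hdε.trans_le (h.antitone hlt.le)).not_ge hεd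
  have hagree : ∀ ω ∈ p ⁻¹' S, ∀ ω' ∈ p ⁻¹' S, ∀ j < k, ω j = ω' j := fun ω hω ω' hω' ↦
    h.eq_of_abs_sub_lt fun j hj ↦
      (hS _ hω _ hω').trans_lt (not_le.1 (Nat.find_min hsmall hj))
  refine (branchMeasure_le hagree).trans (ENNReal.ofReal_le_ofReal ?_)
  have hε : 0 < ε k := h.pos k
  calc (∏ j ∈ Finset.range k, (Fintype.card (ι j) : ℝ)⁻¹) *
        (((fun ω ↦ ω k) '' (p ⁻¹' S)).ncard / Fintype.card (ι k))
      ≤ K * (Fintype.card (ι k) * ε k) ^ s * (2 * d / (Fintype.card (ι k) * ε k)) ^ s := by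
        gcongr
        · exact (Finset.prod_nonneg fun j _ ↦ by positivity).trans (hK k hk)
        · exact hK k hk
        · exact h.ncard_image_div_card_le hagree hεd (fun ω hω ω' hω' ↦ hS _ hω _ hω') hs₀ hs₁
    _ = K * (2 * d) ^ s := by
        rw [mul_assoc, ← Real.mul_rpow (by positivity) (by positivity), mul_div_cancel₀]
        positivity

theorem map_branchMeasure_absolutelyContinuous (h : IsGapSequence p ε) (hp : Measurable p)
    {s K : ℝ} (hs₀ : 0 < s) (hs₁ : s ≤ 1)
    (hK : ∀ᶠ k in atTop, ∏ j ∈ Finset.range k, (Fintype.card (ι j) : ℝ)⁻¹ ≤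
      K * (Fintype.card (ι k) * ε k) ^ s) : (branchMeasure ι).map p ≪ μH[s] := by
  obtain ⟨k₀, hk₀⟩ := eventually_atTop.1 hK
  have hε := h.pos k₀
  refine absolutelyContinuous_hausdorffMeasure_of_measure_le (C := ENNReal.ofReal (K * 2 ^ s))
    (ε := ENNReal.ofReal (ε k₀ / 2)) ENNReal.ofReal_ne_top (by simpa using hε) fun S hS hSε ↦ ?_
  have hfin : Metric.ediam S ≠ ∞ := ne_top_of_le_ne_top ENNReal.ofReal_ne_top hSε
  have hdiam : Metric.diam S ≤ ε k₀ / 2 := ENNReal.toReal_le_of_le_ofReal (by linarith) hSε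
  -- The bound for `d > diam S` also covers the case `diam S = 0`, by continuity.
  have hlim : Tendsto (fun d : ℝ ↦ ENNReal.ofReal (K * (2 * d) ^ s)) (𝓝[>] Metric.diam S)
      (𝓝 (ENNReal.ofReal (K * (2 * Metric.diam S) ^ s))) := by
    have hcont : Continuous fun d : ℝ ↦ K * (2 * d) ^ s :=
      ((continuous_const_mul 2).rpow_const fun _ ↦ .inr hs₀.le).const_mul K
    exact (ENNReal.continuous_ofReal.comp hcont).continuousWithinAt
  have hle : (branchMeasure ι).map p S ≤ ENNReal.ofReal (K * (2 * Metric.diam S) ^ s) := by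
    rw [Measure.map_apply hp hS.measurableSet]
    refine ge_of_tendsto hlim ?_
    filter_upwards [Ioo_mem_nhdsGT (show Metric.diam S < ε k₀ by linarith)] with d hd
    exact h.branchMeasure_preimage_le hs₀ hs₁ hk₀ (Metric.diam_nonneg.trans_lt hd.1) hd.2
      fun x hx y hy ↦ (Metric.dist_le_diam_of_mem' hfin hx hy).trans hd.1.le
  refine hle.trans_eq ?_
  rw [Real.mul_rpow two_pos.le Metric.diam_nonneg, ← mul_assoc,
    ENNReal.ofReal_mul' (by positivity),
    ← ENNReal.ofReal_rpow_of_nonneg Metric.diam_nonneg hs₀.le, Metric.diam,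
    ENNReal.ofReal_toReal hfin]

end IsGapSequence

end CantorScheme

/-! ### Lower bound for the dimension -/

theorem exists_tendsto_and_dist_le {X : Type*} [PseudoMetricSpace X] [CompleteSpace X]
    {u : ℕ → X} {r : ℕ → ℝ} (hu : ∀ k, dist (u k) (u (k + 1)) + r (k + 1) ≤ r k)
    (hr : Tendsto r atTop (𝓝 0)) : ∃ x, Tendsto u atTop (𝓝 x) ∧ ∀ k, dist (u k) x ≤ r k := by
  have hanti : Antitone r := antitone_nat_of_succ_le fun k ↦
    (le_add_of_nonneg_left dist_nonneg).trans (hu k)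
  have hdist (k : ℕ) {l : ℕ} (hkl : k ≤ l) : dist (u k) (u l) + r l ≤ r k := by
    induction l, hkl using Nat.le_induction with
    | base => simp
    | succ l _ ih => linarith [hu l, dist_triangle (u k) (u l) (u (l + 1))]
  have hle (k l : ℕ) (hkl : k ≤ l) : dist (u k) (u l) ≤ r k :=
    (le_add_of_nonneg_right (hanti.le_of_tendsto hr l)).trans (hdist k hkl)
  obtain ⟨x, hx⟩ := cauchySeq_tendsto_of_complete (cauchySeq_of_le_tendsto_0' r hle hr)
  exact ⟨x, hx, fun k ↦ le_of_tendsto (tendsto_const_nhds.dist hx)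
    ((eventually_ge_atTop k).mono (hle k))⟩

theorem one_div_sq_le_abs_sub {y y' : ℚ} (h : y ≠ y') {q : ℕ} (hy : y.den ≤ q)
    (hy' : y'.den ≤ q) : 1 / (q : ℝ) ^ 2 ≤ |(y : ℝ) - y'| := by
  have hq : (0 : ℝ) < q := by exact_mod_cast y.pos.trans_le hy
  have hmul : (y - y') * (y.den * y'.den) = (y.num * y'.den - y'.num * y.den : ℤ) := by
    push_cast
    linear_combination (y'.den : ℚ) * Rat.mul_den_eq_num y - y.den * Rat.mul_den_eq_num y'
  have hcross : y.num * y'.den - y'.num * y.den ≠ 0 := by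
    intro h0
    rw [h0, Int.cast_zero] at hmul
    exact mul_ne_zero (sub_ne_zero.2 h) (by positivity) hmul
  have hone : (1 : ℝ) ≤ |(y : ℝ) - y'| * (y.den * y'.den) := by
    calc (1 : ℝ) ≤ |((y.num * y'.den - y'.num * y.den : ℤ) : ℝ)| := by
          exact_mod_cast Int.one_le_abs hcross
      _ = |((y : ℝ) - y') * (y.den * y'.den)| := by
          exact_mod_cast congrArg (fun z : ℚ ↦ |(z : ℝ)|) hmul.symm
      _ = _ := by rw [abs_mul, abs_of_nonneg (by positivity : (0 : ℝ) ≤ y.den * y'.den)]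
  rw [div_le_iff₀ (by positivity), sq]
  exact hone.trans (by gcongr)

/-- A tree of rational numbers whose vertices at level `k + 1` are elements of `O` of denominator
at most `Q (k + 1)`. Every vertex `y` at level `k` has the `n k + 1` distinct children
`child k y i`, which lie so close to `y` that the limit points of the branches through `y` are
approximated by `y` to the exponent `τ`. By `rpow_div_le`, the number of children of a vertex at
level `k` is at least `Q (k + 1)` to the power `2 - o(1)`. -/
structure ApproximationTree (O : Set ℚ) (τ c : ℝ) where
  Q : ℕ → ℕ
  n : ℕ → ℕ
  child : (k : ℕ) → ℚ → Fin (n k + 1) → ℚ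
  Q_pos (k : ℕ) : 0 < Q k
  two_mul_Q_le (k : ℕ) : 2 * Q k ≤ Q (k + 1)
  rpow_div_le (k : ℕ) : (Q k : ℝ) ^ τ / c ≤ (Q (k + 1) : ℝ) ^ (1 / ((k : ℝ) + 1))
  le_n_add_one (k : ℕ) : c * (Q (k + 1) : ℝ) ^ 2 / (Q k : ℝ) ^ τ ≤ n k + 1
  child_injective (k : ℕ) (y : ℚ) : (child k y).Injective
  child_mem (k : ℕ) (y : ℚ) (i : Fin (n k + 1)) : child k y i ∈ O
  abs_child_sub_le (k : ℕ) (y : ℚ) (i : Fin (n k + 1)) :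
    |(child k y i : ℝ) - y| ≤ 1 / (16 * (Q k : ℝ) ^ τ)
  den_child_le (k : ℕ) (y : ℚ) (i : Fin (n k + 1)) : (child k y i).den ≤ Q (k + 1)

theorem exists_fin_injective {α : Type*} {x : ℝ} (hx : 0 < x) {F : ℚ → Finset α}
    (hF : ∀ y, x ≤ (F y).card) :
    ∃ n : ℕ, x ≤ n + 1 ∧ ∃ g : ℚ → Fin (n + 1) → α, ∀ y, (g y).Injective ∧ ∀ i, g y i ∈ F y := by
  have hn : ⌈x⌉₊ - 1 + 1 = ⌈x⌉₊ := Nat.sub_add_cancel (Nat.ceil_pos.2 hx)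
  have hle (y : ℚ) : ⌈x⌉₊ - 1 + 1 ≤ (F y).card := hn.trans_le (Nat.ceil_le.2 (hF y))
  refine ⟨⌈x⌉₊ - 1, ?_, fun y i ↦ (F y).equivFin.symm (Fin.castLE (hle y) i), fun y ↦ ⟨?_, ?_⟩⟩
  · exact_mod_cast hn ▸ Nat.le_ceil x
  · exact Subtype.val_injective.comp
      ((F y).equivFin.symm.injective.comp (Fin.castLE_injective (hle y)))
  · exact fun i ↦ Subtype.prop _

theorem exists_children {O : Set ℚ} {c : ℝ} (hc : 0 < c)
    (hO : ∀ ρ > 0, ∃ᶠ Q : ℕ in atTop, ∀ x : ℝ, ∃ F : Finset ℚ,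
      (∀ y ∈ F, y ∈ O ∧ |y - x| ≤ ρ ∧ y.den ≤ Q) ∧ c * ρ * Q ^ 2 ≤ F.card)
    {ρ δ : ℝ} (hρ : 0 < ρ) (hδ : 0 < δ) (A : ℕ) (B : ℝ) :
    ∃ Q : ℕ+, A ≤ Q ∧ B ≤ (Q : ℝ) ^ δ ∧ ∃ n : ℕ, c * ρ * (Q : ℝ) ^ 2 ≤ n + 1 ∧
      ∃ child : ℚ → Fin (n + 1) → ℚ, ∀ y, (child y).Injective ∧ ∀ i, child y i ∈ O ∧
        |(child y i : ℝ) - y| ≤ ρ ∧ (child y i).den ≤ Q := by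
  have hroot : Tendsto (fun m : ℕ ↦ (m : ℝ) ^ δ) atTop atTop :=
    (tendsto_rpow_atTop hδ).comp tendsto_natCast_atTop_atTop
  obtain ⟨Q, hF, hA, hB, hQ⟩ := ((hO ρ hρ).and_eventually ((eventually_ge_atTop A).and
    ((hroot.eventually_ge_atTop B).and (eventually_gt_atTop 0)))).exists
  choose F hF hcard using fun y : ℚ ↦ hF y
  obtain ⟨n, hn, child, hchild⟩ := exists_fin_injective (by positivity) hcard
  exact ⟨⟨Q, hQ⟩, hA, hB, n, hn, child, fun y ↦
    ⟨(hchild y).1, fun i ↦ hF y _ ((hchild y).2 i)⟩⟩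

theorem IsRegularSystem.exists_approximationTree {O : Set ℚ} (hO : IsRegularSystem O) (τ : ℝ) :
    ∃ c, 0 < c ∧ Nonempty (ApproximationTree O τ c) := by
  obtain ⟨c, hc, hO⟩ := hO
  choose next hdouble hgrowth n hn child hchild using fun (k : ℕ) (q : ℕ+) ↦
    exists_children hc hO (ρ := 1 / (16 * (q : ℝ) ^ τ)) (δ := 1 / ((k : ℝ) + 1))
      (by positivity) (by positivity) (2 * (q : ℕ)) ((q : ℝ) ^ τ / (c / 16))
  obtain ⟨Q, hQ⟩ : ∃ Q : ℕ → ℕ+, ∀ k, next k (Q k) = Q (k + 1) :=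
    ⟨fun k ↦ Nat.rec 1 next k, fun _ ↦ rfl⟩
  refine ⟨c / 16, by positivity, ⟨{
    Q := fun k ↦ Q k
    n := fun k ↦ n k (Q k)
    child := fun k ↦ child k (Q k)
    Q_pos := fun k ↦ (Q k).pos
    two_mul_Q_le := fun k ↦ hQ k ▸ hdouble k (Q k)
    rpow_div_le := fun k ↦ hQ k ▸ hgrowth k (Q k)
    le_n_add_one := fun k ↦ ?_
    child_injective := fun k y ↦ (hchild k (Q k) y).1
    child_mem := fun k y i ↦ ((hchild k (Q k) y).2 i).1
    abs_child_sub_le := fun k y i ↦ ((hchild k (Q k) y).2 i).2.1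
    den_child_le := fun k y i ↦ hQ k ▸ ((hchild k (Q k) y).2 i).2.2 }⟩⟩
  calc c / 16 * (Q (k + 1) : ℝ) ^ 2 / (Q k : ℝ) ^ τ
      = c * (1 / (16 * (Q k : ℝ) ^ τ)) * (Q (k + 1) : ℝ) ^ 2 := by field_simp
    _ ≤ (n k (Q k) : ℝ) + 1 := hQ k ▸ hn k (Q k)

namespace ApproximationTree

variable {O : Set ℚ} {τ c : ℝ} (T : ApproximationTree O τ c)

/-- The vertex at level `k` of the branch `ω`; the root is `0`. -/
def vertex : ℕ → (∀ k, Fin (T.n k + 1)) → ℚ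
  | 0, _ => 0
  | k + 1, ω => T.child k (vertex k ω) (ω k)

/-- A bound for the distance of the limit points of branches from their vertices at level `k`. -/
noncomputable def radius (k : ℕ) : ℝ := 1 / (8 * (T.Q k : ℝ) ^ τ)

/-- A lower bound for the distance of the limit points of branches that part at level `k`. -/
noncomputable def gap (k : ℕ) : ℝ := 1 / (2 * (T.Q (k + 1) : ℝ) ^ 2)

/-- The limit point of the branch `ω`. -/
noncomputable def point (ω : ∀ k, Fin (T.n k + 1)) : ℝ :=
  limUnder atTop fun k ↦ (T.vertex k ω : ℝ)

theorem one_le_Q (k : ℕ) : (1 : ℝ) ≤ T.Q k := by exact_mod_cast T.Q_pos k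

theorem Q_cast_pos (k : ℕ) : (0 : ℝ) < T.Q k := by exact_mod_cast T.Q_pos k

theorem strictMono_Q : StrictMono T.Q :=
  strictMono_nat_of_lt_succ fun k ↦ by linarith [T.two_mul_Q_le k, T.Q_pos k]

theorem tendsto_Q : Tendsto (fun k ↦ (T.Q k : ℝ)) atTop atTop :=
  tendsto_natCast_atTop_atTop.comp T.strictMono_Q.tendsto_atTop

theorem tendsto_radius (hτ : 0 < τ) : Tendsto T.radius atTop (𝓝 0) :=
  tendsto_const_nhds.div_atTop
    (((tendsto_rpow_atTop hτ).comp T.tendsto_Q).const_mul_atTop (by norm_num))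

theorem radius_succ_le (hτ : 1 ≤ τ) (k : ℕ) : T.radius (k + 1) ≤ T.radius k / 2 := by
  have hpos := T.Q_cast_pos k
  have hQ : 2 * (T.Q k : ℝ) ^ τ ≤ (T.Q (k + 1) : ℝ) ^ τ := by
    calc 2 * (T.Q k : ℝ) ^ τ ≤ 2 ^ τ * (T.Q k : ℝ) ^ τ := by
          gcongr
          exact Real.self_le_rpow_of_one_le one_le_two hτ
      _ = (2 * (T.Q k : ℝ)) ^ τ := (Real.mul_rpow two_pos.le hpos.le).symm
      _ ≤ (T.Q (k + 1) : ℝ) ^ τ := by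
          gcongr
          exact_mod_cast T.two_mul_Q_le k
  rw [radius, radius, div_div]
  exact one_div_le_one_div_of_le (by positivity) (by linarith)

theorem dist_vertex_succ_le (k : ℕ) (ω : ∀ k, Fin (T.n k + 1)) :
    dist (T.vertex k ω : ℝ) (T.vertex (k + 1) ω) ≤ T.radius k / 2 := by
  rw [dist_comm, Real.dist_eq]
  refine (T.abs_child_sub_le k _ _).trans_eq ?_
  rw [radius, div_div]
  ring_nf

theorem tendsto_vertex_and_dist_le (hτ : 1 ≤ τ) (ω : ∀ k, Fin (T.n k + 1)) :
    Tendsto (fun k ↦ (T.vertex k ω : ℝ)) atTop (𝓝 (T.point ω)) ∧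
      ∀ k, dist (T.vertex k ω : ℝ) (T.point ω) ≤ T.radius k := by
  obtain ⟨x, hx, hle⟩ := exists_tendsto_and_dist_le (u := fun k ↦ (T.vertex k ω : ℝ))
    (fun k ↦ by linarith [T.dist_vertex_succ_le k ω, T.radius_succ_le hτ k])
    (T.tendsto_radius (by linarith))
  obtain rfl : T.point ω = x := hx.limUnder_eq
  exact ⟨hx, hle⟩

theorem measurable_vertex (k : ℕ) : Measurable (T.vertex k) := by
  induction k with
  | zero => exact measurable_const
  | succ k ih =>
    exact (measurable_of_countable fun y : ℚ × Fin (T.n k + 1) ↦ T.child k y.1 y.2).comp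
      (ih.prodMk (measurable_pi_apply k))

theorem measurable_point (hτ : 1 ≤ τ) : Measurable T.point :=
  measurable_of_tendsto_metrizable (f := fun k ω ↦ (T.vertex k ω : ℝ))
    (fun k ↦ (measurable_of_countable ((↑) : ℚ → ℝ)).comp (T.measurable_vertex k))
    (tendsto_pi_nhds.2 fun ω ↦ (T.tendsto_vertex_and_dist_le hτ ω).1)

theorem vertex_congr {k : ℕ} {ω ω' : ∀ k, Fin (T.n k + 1)} (h : ∀ j < k, ω j = ω' j) :
    T.vertex k ω = T.vertex k ω' := by
  induction k with
  | zero => rfl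
  | succ k ih =>
    rw [vertex, vertex, ih fun j hj ↦ h j (hj.trans k.lt_succ_self), h k k.lt_succ_self]

theorem gap_le_abs_point_sub (hτ : 2 ≤ τ) {k : ℕ} {ω ω' : ∀ k, Fin (T.n k + 1)}
    (h : ∀ j < k, ω j = ω' j) (hne : ω k ≠ ω' k) : T.gap k ≤ |T.point ω - T.point ω'| := by
  have hvertex : T.vertex (k + 1) ω ≠ T.vertex (k + 1) ω' := by
    rw [vertex, vertex, T.vertex_congr h]
    exact (T.child_injective k _).ne hne
  have hsep : 1 / (T.Q (k + 1) : ℝ) ^ 2 ≤ dist (T.vertex (k + 1) ω : ℝ) (T.vertex (k + 1) ω') :=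
    one_div_sq_le_abs_sub hvertex (T.den_child_le k _ _) (T.den_child_le k _ _)
  have hradius : T.radius (k + 1) ≤ 1 / (T.Q (k + 1) : ℝ) ^ 2 / 8 := by
    have hpos := T.Q_cast_pos (k + 1)
    rw [radius, div_div, mul_comm, ← Real.rpow_two]
    gcongr
    exact T.one_le_Q (k + 1)
  have hgap : T.gap k = 1 / (T.Q (k + 1) : ℝ) ^ 2 / 2 := by rw [gap, div_div, mul_comm]
  have hω := (T.tendsto_vertex_and_dist_le (one_le_two.trans hτ) ω).2 (k + 1)
  have hω' := (T.tendsto_vertex_and_dist_le (one_le_two.trans hτ) ω').2 (k + 1)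
  have hnonneg : 0 ≤ 1 / (T.Q (k + 1) : ℝ) ^ 2 := by positivity
  have htri := dist_triangle4_right (T.vertex (k + 1) ω : ℝ) (T.vertex (k + 1) ω')
    (T.point ω) (T.point ω')
  rw [← Real.dist_eq]
  linarith

theorem isGapSequence (hτ : 2 ≤ τ) : IsGapSequence T.point T.gap where
  pos k := by
    have := T.Q_cast_pos (k + 1)
    rw [gap]
    positivity
  antitone k l hkl := by
    have := T.Q_cast_pos (k + 1)
    rw [gap, gap]
    gcongr
    exact T.strictMono_Q.monotone (by lia)
  tendsto_zero := tendsto_const_nhds.div_atTop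
    (((tendsto_pow_atTop two_ne_zero).comp
      (T.tendsto_Q.comp (tendsto_add_atTop_nat 1))).const_mul_atTop two_pos)
  le_abs_sub := T.gap_le_abs_point_sub hτ

theorem inv_n_add_one_le (hc : 0 < c) (k : ℕ) :
    ((T.n k : ℝ) + 1)⁻¹ ≤ (T.Q k : ℝ) ^ τ / c / (T.Q (k + 1) : ℝ) ^ 2 := by
  have hpos := T.Q_cast_pos k
  have hpos' := T.Q_cast_pos (k + 1)
  refine (inv_anti₀ (by positivity) (T.le_n_add_one k)).trans_eq ?_
  field_simp

theorem eventually_prod_inv_le {s : ℝ} (hc : 0 < c) (hτs : τ * s < 2) :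
    ∀ᶠ k in atTop, ∏ j ∈ Finset.range k, ((T.n j : ℝ) + 1)⁻¹ ≤ (T.Q k : ℝ) ^ (-(τ * s)) := by
  have hexp : ∀ᶠ k : ℕ in atTop, 1 / ((k : ℝ) + 1) ≤ 2 - τ * s :=
    tendsto_one_div_add_atTop_nhds_zero_nat.eventually_le_const (by linarith)
  rw [← map_add_atTop_eq_nat 1, eventually_map]
  filter_upwards [hexp] with k hk
  have hprod : ∏ j ∈ Finset.range k, ((T.n j : ℝ) + 1)⁻¹ ≤ 1 :=
    Finset.prod_le_one (fun _ _ ↦ by positivity) fun j _ ↦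
      inv_le_one_of_one_le₀ (le_add_of_nonneg_left (T.n j).cast_nonneg)
  have hpos := T.Q_cast_pos (k + 1)
  calc ∏ j ∈ Finset.range (k + 1), ((T.n j : ℝ) + 1)⁻¹
      ≤ ((T.n k : ℝ) + 1)⁻¹ := by
        rw [Finset.prod_range_succ]
        exact mul_le_of_le_one_left (by positivity) hprod
    _ ≤ (T.Q k : ℝ) ^ τ / c / (T.Q (k + 1) : ℝ) ^ 2 := T.inv_n_add_one_le hc k
    _ ≤ (T.Q (k + 1) : ℝ) ^ (2 - τ * s) / (T.Q (k + 1) : ℝ) ^ 2 := by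
        gcongr
        exact (T.rpow_div_le k).trans (Real.rpow_le_rpow_of_exponent_le (T.one_le_Q _) hk)
    _ = (T.Q (k + 1) : ℝ) ^ (-(τ * s)) := by
        rw [← Real.rpow_two, ← Real.rpow_sub hpos]
        ring_nf

theorem rpow_neg_le {s : ℝ} (hc : 0 < c) (hs : 0 ≤ s) (k : ℕ) :
    (T.Q k : ℝ) ^ (-(τ * s)) ≤ (2 / c) ^ s * (((T.n k : ℝ) + 1) * T.gap k) ^ s := by
  have hpos := T.Q_cast_pos k
  have hpos' := T.Q_cast_pos (k + 1)
  have hgap : 0 ≤ T.gap k := by rw [gap]; positivity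
  calc (T.Q k : ℝ) ^ (-(τ * s)) = (((T.Q k : ℝ) ^ τ)⁻¹) ^ s := by
        rw [← Real.rpow_neg hpos.le, ← Real.rpow_mul hpos.le, neg_mul]
    _ = (2 / c * (c * (T.Q (k + 1) : ℝ) ^ 2 / (T.Q k : ℝ) ^ τ * T.gap k)) ^ s := by
        rw [gap]
        field_simp
    _ ≤ (2 / c * (((T.n k : ℝ) + 1) * T.gap k)) ^ s := by
        gcongr
        exact T.le_n_add_one k
    _ = _ := Real.mul_rpow (by positivity) (by positivity)

theorem ae_point_notMem (hc : 0 < c) (hτ : 2 ≤ τ) {s : ℝ} (hs : 0 < s) (hτs : τ * s < 2)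
    {N : Set ℝ} (hN : μH[s] N = 0) :
    ∀ᵐ ω ∂branchMeasure fun k ↦ Fin (T.n k + 1), T.point ω ∉ N := by
  have hmeas := T.measurable_point (one_le_two.trans hτ)
  have hac := (T.isGapSequence hτ).map_branchMeasure_absolutelyContinuous hmeas hs (by nlinarith)
    (K := (2 / c) ^ s) <| (T.eventually_prod_inv_le hc hτs).mono fun k hk ↦ by
      simpa using hk.trans (T.rpow_neg_le hc hs.le k)
  exact measure_eq_zero_iff_ae_notMem.1
    (Measure.preimage_null_of_map_null hmeas.aemeasurable (hac hN))

theorem isApproxExponent_point (hτ : 1 ≤ τ) {ω : ∀ k, Fin (T.n k + 1)}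
    (hω : Irrational (T.point ω)) : IsApproxExponent O (T.point ω) τ := by
  obtain ⟨hlim, hdist⟩ := T.tendsto_vertex_and_dist_le hτ ω
  refine ⟨1, fun hfin ↦ hω ?_⟩
  have hclosed : IsClosed (((↑) : ℚ → ℝ) '' _) := (hfin.image _).isClosed
  refine Set.image_subset_range _ _ (hclosed.mem_of_tendsto (hlim.comp (tendsto_add_atTop_nat 1))
    (.of_forall fun k ↦ ⟨T.vertex (k + 1) ω, ⟨T.child_mem _ _ _, ?_⟩, rfl⟩))
  have hden : ((T.vertex (k + 1) ω).den : ℝ) ≤ T.Q (k + 1) := by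
    exact_mod_cast T.den_child_le k _ _
  have hden₀ : (0 : ℝ) < (T.vertex (k + 1) ω).den := by exact_mod_cast Rat.pos _
  rw [abs_sub_comm]
  refine (hdist (k + 1)).trans (one_div_le_one_div_of_le (Real.rpow_pos_of_pos hden₀ τ) ?_)
  calc ((T.vertex (k + 1) ω).den : ℝ) ^ τ ≤ (T.Q (k + 1) : ℝ) ^ τ := by gcongr
    _ ≤ 8 * (T.Q (k + 1) : ℝ) ^ τ :=
        le_mul_of_one_le_left (Real.rpow_nonneg (Nat.cast_nonneg _) _) (by norm_num)

theorem ae_irrational_point (hc : 0 < c) (hτ : 2 ≤ τ) :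
    ∀ᵐ ω ∂branchMeasure fun k ↦ Fin (T.n k + 1), Irrational (T.point ω) := by
  have hτ₀ : 0 < τ := two_pos.trans_le hτ
  have hnull : μH[((1 / τ).toNNReal : ℝ)] (Set.range ((↑) : ℚ → ℝ)) = 0 := by
    refine hausdorffMeasure_of_dimH_lt ?_
    rw [(Set.countable_range _).dimH_zero]
    simpa using hτ₀
  rw [Real.coe_toNNReal _ (by positivity)] at hnull
  refine T.ae_point_notMem hc hτ (by positivity) ?_ hnull
  rw [mul_one_div_cancel hτ₀.ne']
  exact one_lt_two

theorem ae_approxExponent_point_eq (hc : 0 < c) (hτ : 2 ≤ τ) :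
    ∀ᵐ ω ∂branchMeasure fun k ↦ Fin (T.n k + 1), approxExponent O (T.point ω) = τ := by
  have hτ₀ : 0 < τ := two_pos.trans_le hτ
  have hle : ∀ᵐ ω ∂branchMeasure fun k ↦ Fin (T.n k + 1), approxExponent O (T.point ω) ≤ τ := by
    refine (ae_le_const_iff_forall_gt_measure_zero _ _).2 fun b hb ↦ ?_
    obtain ⟨t, hτt, htb⟩ := EReal.lt_iff_exists_real_btwn.1 hb
    replace hτt : τ < t := by exact_mod_cast hτt
    obtain ⟨s, hts, hsτ⟩ := exists_between (div_lt_div_of_pos_left two_pos hτ₀ hτt)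
    have ht₀ : 0 < t := hτ₀.trans hτt
    have hs₀ : 0 < s := (by positivity : 0 < 2 / t).trans hts
    have hnull := hausdorffMeasure_setOf_isApproxExponent_eq_zero O hs₀ ((div_lt_iff₀' ht₀).1 hts)
    have hae := T.ae_point_notMem hc hτ hs₀ ((lt_div_iff₀' hτ₀).1 hsτ) hnull
    exact measure_mono_null
      (fun ω hω ↦ isApproxExponent_of_lt_approxExponent (htb.trans_le hω))
      (measure_eq_zero_iff_ae_notMem.2 hae)
  filter_upwards [hle, T.ae_irrational_point hc hτ] with ω hω hirr
  exact hω.antisymm (T.isApproxExponent_point (one_le_two.trans hτ) hirr).le_approxExponent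

end ApproximationTree

theorem IsRegularSystem.le_dimH_setOf_approxExponent_eq {O : Set ℚ} (hO : IsRegularSystem O)
    {τ : NNReal} (hτ : 2 ≤ τ) : 2 / (τ : ℝ≥0∞) ≤ dimH {x | approxExponent O x = (τ : ℝ)} := by
  obtain ⟨c, hc, ⟨T⟩⟩ := hO.exists_approximationTree τ
  have hτ' : (2 : ℝ) ≤ τ := by exact_mod_cast hτ
  refine le_of_forall_lt fun b hb ↦ ?_
  obtain ⟨s, hbs, hs⟩ := ENNReal.lt_iff_exists_nnreal_btwn.1 hb
  refine hbs.trans_le (le_dimH_of_hausdorffMeasure_ne_zero fun hnull ↦ ?_)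
  have hs₀ : (0 : ℝ) < s := by exact_mod_cast pos_of_gt hbs
  have hτs : (τ : ℝ) * s < 2 := by
    have hmul : (s : ℝ≥0∞) * τ < 2 := by
      rwa [ENNReal.lt_div_iff_mul_lt (by simp) (by simp)] at hs
    rw [mul_comm]
    exact_mod_cast hmul
  obtain ⟨ω, hω, hω'⟩ := ((T.ae_approxExponent_point_eq hc hτ').and
    (T.ae_point_notMem hc hτ' hs₀ hτs hnull)).exists
  exact hω' hω

theorem IsRegularSystem.dimH_setOf_approxExponent_eq {O : Set ℚ} (hO : IsRegularSystem O)
    {τ : ℝ≥0∞} (hτ : 2 ≤ τ) : dimH {x | approxExponent O x = τ} = 2 / τ := by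
  refine (dimH_setOf_approxExponent_eq_le O τ).antisymm ?_
  induction τ with
  | top => simp
  | coe τ => exact hO.le_dimH_setOf_approxExponent_eq (by exact_mod_cast hτ)

theorem nonCuspidalExponent_eq_approxExponent (Γ : Subgroup SL(2, ℤ)) [Γ.FiniteIndex] (r : ℝ)
    (f : UpperHalfPlane → ℂ) (x : ℝ) :
    nonCuspidalExponent Γ r f x =
      approxExponent {y : ℚ | ¬ IsCuspidalAt Γ r f (y : OnePoint ℚ)} x :=
  rfl

theorem corollary6p3_general (Γ : Subgroup SL(2, ℤ)) [Γ.FiniteIndex] (r : ℝ) (μ : Γ → ℂˣ)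
    (f : UpperHalfPlane → ℂ) (hf : IsAutomorphic Γ r μ f)
    (hcusp : ¬ ∀ 𝔞 : OnePoint ℚ, IsCuspidalAt Γ r f 𝔞)
    (τ : ℝ≥0∞) (hτ : 2 ≤ τ) :
    dimH {x : ℝ | nonCuspidalExponent Γ r f x = (τ : EReal)} = 2 / τ := by
  obtain ⟨C, hC⟩ := hf.exists_isWellDistributed hcusp
  simp only [nonCuspidalExponent_eq_approxExponent]
  exact hC.isRegularSystem.dimH_setOf_approxExponent_eq hτ

theorem corollary6p3 (Γ : Subgroup SL(2, ℤ)) [Γ.FiniteIndex] (r : ℝ) (μ : Γ → Circle)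
    (f : UpperHalfPlane → ℂ) (hf : IsModularFormOfWeight Γ r μ f)
    (hcusp : ¬ ∀ 𝔞 : OnePoint ℚ, IsCuspidalAt Γ r f 𝔞)
    (τ : ℝ≥0∞) (hτ : 2 ≤ τ) :
    dimH {x : ℝ | nonCuspidalExponent Γ r f x = (τ : EReal)} = 2 / τ :=
  corollary6p3_general Γ r _ f hf.isAutomorphic hcusp τ hτ
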